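/- \textsc{Critical Node Cut} is the following problem: given a finite simple undirected graph $G$ and integers $k, x \ge 0$, decide whether there is a set $C \subseteq V(G)$ of at most $k$ vertices such that $G - C$ has at most $x$ connected pairs, where a connected pair of $G-C$ is an ordered pair $(u,v)$ of distinct vertices that lie in the same connected component of $G-C$. A parameterized problem $A$ is \emph{reducible} to a parameterized problem $B$ if there are computable functions $f, g\colon \mathbb{N} \to \mathbb{N}$, a constant $c$, and an algorithm that maps every $(I,k)$ in time at most $f(k)\cdot |I|^{c}$ to some $(I',k')$ with $k' \le g(k)$ such that $(I,k) \in A$ if and only if $(I',k') \in B$. A Boolean circuit is built from input nodes, negations, and AND- and OR-gates of arbitrary fan-in; its depth is the maximum number of gates, and its weft the maximum number of gates of fan-in more than $2$, on a path to the output. The class $\mathrm{W}[1]$ consists of all parameterized problems that are reducible, for some constant $h$, to the following problem with parameter $k$: given a circuit of weft at most $1$ and depth at most $h$, and $k \in \mathbb{N}$, is there a satisfying assignment that sets exactly $k$ input variables to true? \textbf{Theorem.} \textsc{Critical Node Cut} parameterized by $k$ is $\mathrm{W}[1]$-hard, that is, every problem in $\mathrm{W}[1]$ is reducible to it. -/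

import Mathlib

namespace ParamComplexity

/-! ### Data: finite binary trees (S-expressions over a single atom)

These are the words over which problems are posed.  A bit string is the list of its bits, so
every decision problem over bit strings is, up to a linear change of size, a problem over trees. -/

/-- S-expressions over one atom `nil`. -/
inductive SExp : Type
  | nil : SExp
  | cons : SExp → SExp → SExp
  deriving DecidableEq

namespace SExp

/-- The length of an S-expression: the number of its nodes. -/
def size : SExp → ℕ
  | nil => 1
  | cons a b => size a + size b + 1

/-- First component (`nil` for the atom). -/
def hd : SExp → SExp
  | nil => nil
  | cons a _ => a

/-- Second component (`nil` for the atom). -/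
def tl : SExp → SExp
  | nil => nil
  | cons _ b => b

/-- Natural numbers in unary. -/
def num : ℕ → SExp
  | 0 => nil
  | n + 1 => cons nil (num n)

/-- Lists of S-expressions. -/
def list : List SExp → SExp
  | [] => nil
  | a :: l => cons a (list l)

end SExp

/-! ### The machine model: WHILE programs on S-expressions, with running time

A store has a variable for every natural number.  The running time of a program is the sum of the
costs of the elementary steps that it performs; an elementary step costs one plus the total size
of all values that occur in it, so that time is polynomially related to Turing machine time
(in particular no value can be larger than the time spent to build it). -/

/-- Stores. -/
abbrev Store : Type := ℕ → SExp

/-- Expressions. -/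
inductive Expr : Type
  | var : ℕ → Expr
  | nil : Expr
  | cons : Expr → Expr → Expr
  | hd : Expr → Expr
  | tl : Expr → Expr
  | eq : Expr → Expr → Expr

namespace Expr

/-- The value of an expression; an equality test yields a non-`nil` value iff it succeeds. -/
def val (s : Store) : Expr → SExp
  | var i => s i
  | nil => SExp.nil
  | cons a b => SExp.cons (val s a) (val s b)
  | hd a => (val s a).hd
  | tl a => (val s a).tl
  | eq a b => if val s a = val s b then SExp.cons SExp.nil SExp.nil else SExp.nil

/-- The cost of evaluating an expression: the sum of the sizes of the values of all its
subexpressions (itself included). -/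
def cost (s : Store) : Expr → ℕ
  | var i => (s i).size
  | nil => 1
  | cons a b => cost s a + cost s b + (val s (cons a b)).size
  | hd a => cost s a + (val s (hd a)).size
  | tl a => cost s a + (val s (tl a)).size
  | eq a b => cost s a + cost s b + (val s (eq a b)).size

end Expr

/-- Programs. -/
inductive Prog : Type
  | assign : ℕ → Expr → Prog
  | seq : Prog → Prog → Prog
  | ite : Expr → Prog → Prog → Prog
  | loop : Expr → Prog → Prog

/-- `Exec p s t s'`: started in the store `s`, the program `p` halts after time `t` in the store
`s'`.  In conditionals and loops, a test counts as true iff its value is not `nil`;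
`loop e p` repeats `p` as long as `e` is true. -/
inductive Exec : Prog → Store → ℕ → Store → Prop
  | assign (i : ℕ) (e : Expr) (s : Store) :
      Exec (Prog.assign i e) s (e.cost s + 1) (Function.update s i (e.val s))
  | seq {p q : Prog} {s s' s'' : Store} {t t' : ℕ} :
      Exec p s t s' → Exec q s' t' s'' → Exec (Prog.seq p q) s (t + t') s''
  | ite_true {e : Expr} {p q : Prog} {s s' : Store} {t : ℕ} :
      e.val s ≠ SExp.nil → Exec p s t s' → Exec (Prog.ite e p q) s (e.cost s + 1 + t) s'
  | ite_false {e : Expr} {p q : Prog} {s s' : Store} {t : ℕ} :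
      e.val s = SExp.nil → Exec q s t s' → Exec (Prog.ite e p q) s (e.cost s + 1 + t) s'
  | loop_true {e : Expr} {p : Prog} {s s' s'' : Store} {t t' : ℕ} :
      e.val s ≠ SExp.nil → Exec p s t s' → Exec (Prog.loop e p) s' t' s'' →
      Exec (Prog.loop e p) s (e.cost s + 1 + t + t') s''
  | loop_false {e : Expr} {p : Prog} {s : Store} :
      e.val s = SExp.nil → Exec (Prog.loop e p) s (e.cost s + 1) s

/-- The initial store on the input `a`: variable `0` holds `a`, all others hold `nil`. -/
def inputStore (a : SExp) : Store := Function.update (fun _ => SExp.nil) 0 a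

/-- On input `a`, the program `p` halts after time `t` with output `b` (in variable `0`). -/
def Outputs (p : Prog) (a : SExp) (t : ℕ) (b : SExp) : Prop :=
  ∃ s : Store, Exec p (inputStore a) t s ∧ s 0 = b

/-! ### Parameterized problems and reductions -/

/-- A parameterized problem: a set of pairs (instance, parameter). -/
abbrev ParamProblem : Type := Set (SExp × ℕ)

/-- The pair (instance, parameter) as an input or output of a program. -/
def pair (x : SExp) (k : ℕ) : SExp := SExp.cons x (SExp.num k)

/-- Parameterized many-one reducibility: some program maps each `(x, k)` in time
`f k * |x| ^ c` to some `(x', k')` with `k' ≤ g k` that is a yes-instance of `B` iff `(x, k)` is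
one of `A`, where `f` and `g` are computable and `c` is a constant. -/
def FPTReducible (A B : ParamProblem) : Prop :=
  ∃ (p : Prog) (f g : ℕ → ℕ) (c : ℕ), Computable f ∧ Computable g ∧
    ∀ (x : SExp) (k : ℕ), ∃ (x' : SExp) (k' t : ℕ),
      Outputs p (pair x k) t (pair x' k') ∧ t ≤ f k * x.size ^ c ∧ k' ≤ g k ∧
        ((x, k) ∈ A ↔ (x', k') ∈ B)

/-! ### Boolean circuits, weft, and the classes `W[t]` -/

/-- A node of a circuit: an input node, or a gate together with the indices of the nodes that
feed it. -/
inductive Gate : Type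
  | inp : ℕ → Gate
  | not : ℕ → Gate
  | and : List ℕ → Gate
  | or : List ℕ → Gate

namespace Gate

/-- The nodes that feed a node. -/
def preds : Gate → List ℕ
  | inp _ => []
  | not j => [j]
  | and js => js
  | or js => js

/-- Large gates are those of fan-in more than two. -/
def IsLarge (g : Gate) : Prop := 2 < g.preds.length

instance (g : Gate) : Decidable g.IsLarge := inferInstanceAs (Decidable (2 < g.preds.length))

/-- The value of a node, if exactly the input variables in `S` are true and `vs` lists the values
of the preceding nodes. -/
def value (S : Finset ℕ) (vs : List Bool) : Gate → Bool
  | inp i => decide (i ∈ S)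
  | not j => !(vs.getD j false)
  | and js => js.all fun j => vs.getD j false
  | or js => js.any fun j => vs.getD j false

/-- The largest number of gates on a path ending in a node, if `ds` lists these numbers for the
preceding nodes. -/
def depth (ds : List ℕ) : Gate → ℕ
  | inp _ => 0
  | g => (g.preds.map fun j => ds.getD j 0).foldr max 0 + 1

/-- The largest number of large gates on a path ending in a node, if `ws` lists these numbers for
the preceding nodes. -/
def weft (ws : List ℕ) (g : Gate) : ℕ :=
  (g.preds.map fun j => ws.getD j 0).foldr max 0 + if g.IsLarge then 1 else 0

/-- Encoding of nodes. -/
def enc : Gate → SExp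
  | inp i => SExp.cons (SExp.num 0) (SExp.num i)
  | not j => SExp.cons (SExp.num 1) (SExp.num j)
  | and js => SExp.cons (SExp.num 2) (SExp.list (js.map SExp.num))
  | or js => SExp.cons (SExp.num 3) (SExp.list (js.map SExp.num))

end Gate

/-- A circuit: the number of its input variables `0, …, inputs - 1`, and its nodes in topological
order; the last node is the output node. -/
structure Circuit : Type where
  inputs : ℕ
  gates : List Gate

namespace Circuit

/-- There is an output node, each node is fed by earlier nodes only, and the input nodes carry
variables of the circuit. -/
def WellFormed (C : Circuit) : Prop :=
  C.gates ≠ [] ∧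
  (∀ (i : ℕ) (g : Gate), C.gates[i]? = some g → ∀ j ∈ g.preds, j < i) ∧
  ∀ i : ℕ, Gate.inp i ∈ C.gates → i < C.inputs

/-- Runs through the nodes in order, and lists for each node the result of `step`, which may use
the list of the results for the preceding nodes. -/
def run {β : Type} (step : List β → Gate → β) (gs : List Gate) : List β :=
  gs.foldl (fun vs g => vs ++ [step vs g]) []

/-- The value of the output node if exactly the input variables in `S` are true. -/
def eval (C : Circuit) (S : Finset ℕ) : Bool := (run (Gate.value S) C.gates).getLastD false

/-- The largest number of gates on a path to the output node. -/
def depth (C : Circuit) : ℕ := (run Gate.depth C.gates).getLastD 0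

/-- The largest number of large gates on a path to the output node. -/
def weft (C : Circuit) : ℕ := (run Gate.weft C.gates).getLastD 0

/-- Encoding of circuits. -/
def enc (C : Circuit) : SExp := SExp.cons (SExp.num C.inputs) (SExp.list (C.gates.map Gate.enc))

end Circuit

/-- Weighted circuit satisfiability for circuits of weft at most `t` and depth at most `h`,
parameterized by the weight: does the circuit have a satisfying assignment that makes exactly `k`
input variables true? -/
def weightedCircuitSat (t h : ℕ) : ParamProblem :=
  {a | ∃ C : Circuit, C.WellFormed ∧ C.weft ≤ t ∧ C.depth ≤ h ∧ a.1 = C.enc ∧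
    ∃ S : Finset ℕ, S ⊆ Finset.range C.inputs ∧ S.card = a.2 ∧ C.eval S = true}

/-- The class `W[t]`: the problems that are reducible, for some constant `h`, to weighted
satisfiability of circuits of weft at most `t` and depth at most `h`. -/
def W (t : ℕ) : Set ParamProblem := {L | ∃ h : ℕ, FPTReducible L (weightedCircuitSat t h)}

/-- `W[1]`-hardness: every problem in `W[1]` is reducible to `B`. -/
def W1Hard (B : ParamProblem) : Prop := ∀ A ∈ W 1, FPTReducible A B

/-! ### Critical Node Cut -/

/-- The ordered connected pairs of `G - C`: the pairs of distinct vertices of `G - C` that lie in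
the same connected component of `G - C`. -/
def connectedPairs {V : Type} (G : SimpleGraph V) (C : Finset V) :
    Set ({v : V | v ∉ C} × {v : V | v ∉ C}) :=
  {p | p.1 ≠ p.2 ∧ (G.induce {v : V | v ∉ C}).Reachable p.1 p.2}

/-- Some set of at most `k` vertices leaves at most `x` connected pairs when removed. -/
def HasCriticalNodeCut {n : ℕ} (G : SimpleGraph (Fin n)) (k x : ℕ) : Prop :=
  ∃ C : Finset (Fin n), C.card ≤ k ∧ (connectedPairs G C).ncard ≤ x

/-- `E` lists the edges of the simple graph `G` (each in at least one of its two directions). -/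
def ListsEdges {n : ℕ} (G : SimpleGraph (Fin n)) (E : List (Fin n × Fin n)) : Prop :=
  ∀ u v : Fin n, G.Adj u v ↔ (u, v) ∈ E ∨ (v, u) ∈ E

/-- Encoding of a graph on `n` vertices with edge list `E`, together with the bound `x`. -/
def encGraph {n : ℕ} (E : List (Fin n × Fin n)) (x : ℕ) : SExp :=
  SExp.cons (SExp.num n) (SExp.cons
    (SExp.list (E.map fun e => SExp.cons (SExp.num e.1.val) (SExp.num e.2.val)))
    (SExp.num x))

/-- Critical Node Cut, parameterized by the cut size `k`. The instance consists of the graph, as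
an edge list, and the bound `x`. (Numbers are in unary, which can only make the problem easier;
hardness for `x` in binary follows.) -/
def criticalNodeCut : ParamProblem :=
  {a | ∃ (n : ℕ) (G : SimpleGraph (Fin n)) (E : List (Fin n × Fin n)) (x : ℕ),
    ListsEdges G E ∧ a.1 = encGraph E x ∧ HasCriticalNodeCut G a.2 x}

end ParamComplexity

/-!
A circuit of weft one and bounded depth computes a disjunction of polynomially many conjunctions,
each of polynomially many constraints `p = 1` for polynomials `p`: bounded-depth pieces without
large gates are polynomials of bounded degree with values zero and one, and a path to the output
meets at most one large gate, so that below the small gates next to the output one guesses which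
inputs of the large disjunctions are true. An additional variable per conjunction, of which
exactly one is selected, chooses the disjunct. Satisfiability by `k` variables thus asks whether a
single polynomial of bounded degree, the number of constraints being a penalty term, reaches a given
value on some set of `k + 1` variables.

A negative monomial can be traded for all other tuples of variables, up to a constant, since the
number of tuples inside a set depends only on the cardinality of the set. So one has to find a set
of `k + 1` variables that contains many members of a given list of bounded-size tuples. Make the
variables a clique, and attach one vertex per tuple to the variables in it: deleting a set of
variables isolates exactly the tuples inside it, while everything else stays in one component.
-/

namespace ParamComplexity

/-! ### Running programs within time bounds -/

theorem SExp.size_pos (a : SExp) : 0 < a.size := by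
  cases a <;> exact Nat.succ_pos _

theorem SExp.size_hd_le : ∀ a : SExp, a.hd.size ≤ a.size
  | nil => le_rfl
  | cons a b => by simp only [hd, size]; omega

theorem SExp.size_tl_le : ∀ a : SExp, a.tl.size ≤ a.size
  | nil => le_rfl
  | cons a b => by simp only [tl, size]; omega

theorem Expr.size_val_le_cost (s : Store) : ∀ e : Expr, (e.val s).size ≤ e.cost s
  | var _ => le_rfl
  | nil => le_rfl
  | cons _ _ => Nat.le_add_left _ _
  | hd _ => Nat.le_add_left _ _
  | tl _ => Nat.le_add_left _ _
  | eq _ _ => Nat.le_add_left _ _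

theorem Exec.size_le {p : Prog} {s s' : Store} {t : ℕ} (h : Exec p s t s') (i : ℕ) :
    (s' i).size ≤ (s i).size + t := by
  induction h with
  | assign j e s =>
    have := e.size_val_le_cost s
    rcases eq_or_ne i j with rfl | hij
    · rw [Function.update_self]; omega
    · rw [Function.update_of_ne hij]; omega
  | seq => omega
  | ite_true => omega
  | ite_false => omega
  | loop_true => omega
  | loop_false => omega

/-- `p` leads from the store `s` to the store `s'` within time `T`. -/
def Run (p : Prog) (s : Store) (T : ℕ) (s' : Store) : Prop := ∃ t ≤ T, Exec p s t s'

namespace Run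

variable {p q : Prog} {s s' s'' : Store} {T T' : ℕ} {e : Expr}

theorem mono (h : Run p s T s') (hT : T ≤ T') : Run p s T' s' :=
  h.imp fun _ ⟨ht, h⟩ => ⟨ht.trans hT, h⟩

theorem size_le (h : Run p s T s') (i : ℕ) : (s' i).size ≤ (s i).size + T := by
  obtain ⟨t, ht, h⟩ := h
  exact (h.size_le i).trans (by omega)

theorem assign {v : SExp} (i : ℕ) (hv : e.val s = v) (hT : e.cost s ≤ T) :
    Run (.assign i e) s (T + 1) (Function.update s i v) :=
  ⟨_, by omega, hv ▸ Exec.assign i e s⟩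

theorem seq (h : Run p s T s') (h' : Run q s' T' s'') : Run (.seq p q) s (T + T') s'' := by
  obtain ⟨t, ht, h⟩ := h
  obtain ⟨t', ht', h'⟩ := h'
  exact ⟨t + t', by omega, h.seq h'⟩

theorem ite_true (he : e.val s ≠ SExp.nil) (h : Run p s T s') :
    Run (.ite e p q) s (e.cost s + 1 + T) s' := by
  obtain ⟨t, ht, h⟩ := h
  exact ⟨_, by omega, h.ite_true he⟩

theorem ite_false (he : e.val s = SExp.nil) (h : Run q s T s') :
    Run (.ite e p q) s (e.cost s + 1 + T) s' := by
  obtain ⟨t, ht, h⟩ := h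
  exact ⟨_, by omega, h.ite_false he⟩

theorem loop_true (he : e.val s ≠ SExp.nil) (h : Run p s T s') (h' : Run (.loop e p) s' T' s'') :
    Run (.loop e p) s (e.cost s + 1 + T + T') s'' := by
  obtain ⟨t, ht, h⟩ := h
  obtain ⟨t', ht', h'⟩ := h'
  exact ⟨_, by omega, h.loop_true he h'⟩

theorem loop_false (he : e.val s = SExp.nil) : Run (.loop e p) s (e.cost s + 1) s :=
  ⟨_, le_rfl, .loop_false he⟩

end Run

/-! ### Encodings -/

/-- Types whose elements are encoded by S-expressions, so that programs can work on them. -/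
class Enc (α : Type*) where
  enc : α → SExp
  enc_injective : Function.Injective enc

open Enc

theorem SExp.list_injective : Function.Injective SExp.list
  | [], [], _ => rfl
  | a :: l, b :: l', h => by rw [(SExp.cons.inj h).1, list_injective (SExp.cons.inj h).2]

theorem SExp.num_injective : Function.Injective SExp.num
  | 0, 0, _ => rfl
  | n + 1, m + 1, h => by rw [num_injective (SExp.cons.inj h).2]

section Encodings

variable {α β : Type*} [Enc α] [Enc β]

instance : Enc SExp := ⟨id, Function.injective_id⟩

instance : Enc (α × β) :=
  ⟨fun p => SExp.cons (enc p.1) (enc p.2), fun _ _ h =>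
    Prod.ext (enc_injective (SExp.cons.inj h).1) (enc_injective (SExp.cons.inj h).2)⟩

instance : Enc Bool := ⟨fun b => if b then SExp.cons SExp.nil SExp.nil else SExp.nil, by decide⟩

instance : Enc (List α) :=
  ⟨fun l => SExp.list (l.map enc),
    SExp.list_injective.comp (List.map_injective_iff.mpr enc_injective)⟩

instance : Enc ℕ := ⟨SExp.num, SExp.num_injective⟩

instance : Enc Unit := ⟨fun _ => SExp.nil, Function.injective_of_subsingleton _⟩

theorem enc_pair (a : α) (b : β) : enc (a, b) = SExp.cons (enc a) (enc b) := rfl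

theorem enc_true : enc true = SExp.cons SExp.nil SExp.nil := rfl

theorem enc_false : enc false = SExp.nil := rfl

theorem enc_nil : enc ([] : List α) = SExp.nil := rfl

theorem enc_cons (a : α) (l : List α) : enc (a :: l) = SExp.cons (enc a) (enc l) := rfl

theorem enc_nat : ∀ n : ℕ, enc n = enc (List.replicate n ())
  | 0 => rfl
  | n + 1 => congrArg (SExp.cons SExp.nil) (enc_nat n)

/-- The size of an object, that is, of its encoding. -/
def esize (a : α) : ℕ := (enc a).size

theorem size_enc (a : α) : (enc a).size = esize a := rfl

theorem esize_pos (a : α) : 0 < esize a := SExp.size_pos _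

theorem esize_pair (a : α) (b : β) : esize (a, b) = esize a + esize b + 1 := rfl

theorem esize_bool_le (b : Bool) : esize b ≤ 3 := by revert b; decide

theorem esize_nat : ∀ n : ℕ, esize n = 2 * n + 1
  | 0 => rfl
  | n + 1 => by
    change 1 + esize n + 1 = _
    rw [esize_nat n]
    ring

theorem esize_nil : esize ([] : List α) = 1 := rfl

theorem esize_cons (a : α) (l : List α) : esize (a :: l) = esize a + esize l + 1 := rfl

theorem esize_append (l l' : List α) : esize (l ++ l') + 1 = esize l + esize l' := by
  induction l with
  | nil => rw [List.nil_append, esize_nil, add_comm]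
  | cons a l ih => rw [List.cons_append, esize_cons, esize_cons]; omega

theorem esize_reverse (l : List α) : esize l.reverse = esize l := by
  induction l with
  | nil => rfl
  | cons a l ih =>
    have := esize_append l.reverse [a]
    rw [esize_cons, esize_nil] at this
    rw [List.reverse_cons, esize_cons]
    omega

theorem length_le_esize (l : List α) : l.length ≤ esize l := by
  induction l with
  | nil => exact Nat.zero_le _
  | cons a l ih => rw [esize_cons, List.length_cons]; omega

theorem esize_le_of_suffix {l l' : List α} (h : l <:+ l') : esize l ≤ esize l' := by
  obtain ⟨k, rfl⟩ := h
  have := esize_append k l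
  have := esize_pos k
  omega

theorem esize_le_of_prefix {l l' : List α} (h : l <+: l') : esize l ≤ esize l' := by
  obtain ⟨k, rfl⟩ := h
  have := esize_append l k
  have := esize_pos k
  omega

theorem esize_le_of_mem {a : α} {l : List α} (h : a ∈ l) : esize a ≤ esize l := by
  obtain ⟨k, k', rfl⟩ := List.append_of_mem h
  refine le_trans ?_ (esize_le_of_suffix (List.suffix_append k (a :: k')))
  rw [esize_cons]
  omega

theorem esize_flatMap_le {ι : Type*} {f : ι → List β} {B : ℕ} (l : List ι)
    (h : ∀ a ∈ l, esize (f a) ≤ B) : esize (l.flatMap f) ≤ l.length * B + 1 := by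
  induction l with
  | nil => simp [esize_nil]
  | cons a l ih =>
    have := ih fun b hb => h b (List.mem_cons_of_mem a hb)
    have := h a List.mem_cons_self
    have := esize_append (f a) (l.flatMap f)
    rw [List.flatMap_cons, List.length_cons, add_mul, one_mul]
    omega

theorem esize_range_le (n : ℕ) : esize (List.range n) ≤ n * (2 * n + 2) + 1 := by
  induction n with
  | zero => rfl
  | succ n ih =>
    have := esize_append (List.range n) [n]
    rw [esize_cons, esize_nil, esize_nat] at this
    rw [List.range_succ]
    linarith

end Encodings

/-! ### Functions computable in polynomial time -/

theorem monotone_eval_nat (P : Polynomial ℕ) : Monotone fun n : ℕ => P.eval n := by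
  intro a b h
  simp only [Polynomial.eval_eq_sum, Polynomial.sum]
  gcongr

section Computes

variable {α β γ δ : Type*} [Enc α] [Enc β] [Enc γ] [Enc δ]

/-- Started in any store, `p` computes `f` from the variable `i` to the variable `j` in time `P`,
and keeps all variables below `k` other than `j`. -/
def Computes (p : Prog) (i j k : ℕ) (f : α → β) (P : Polynomial ℕ) : Prop :=
  ∀ (a : α) (s : Store), s i = enc a → ∃ s' : Store, Run p s (P.eval (esize a)) s' ∧
    s' j = enc (f a) ∧ ∀ l < k, l ≠ j → s' l = s l

/-- `f` is computable in polynomial time. The input and output variables and the number of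
protected variables are arbitrary, so that programs can be composed without renaming variables;
the time bound must not depend on them. -/
def PolyTime (f : α → β) : Prop :=
  ∃ P : Polynomial ℕ, ∀ i j k : ℕ, ∃ p : Prog, Computes p i j k f P

namespace PolyTime

theorem exists_esize_le {f : α → β} (hf : PolyTime f) :
    ∃ P : Polynomial ℕ, ∀ a, esize (f a) ≤ P.eval (esize a) := by
  obtain ⟨P, hP⟩ := hf
  obtain ⟨p, hp⟩ := hP 0 0 0
  refine ⟨Polynomial.X + P, fun a => ?_⟩
  obtain ⟨s', hrun, hout, -⟩ := hp a (fun _ => enc a) rfl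
  simpa only [Polynomial.eval_add, Polynomial.eval_X, hout, size_enc] using hrun.size_le 0

theorem of_expr {f : α → β} (e : ℕ → Expr) (P : Polynomial ℕ)
    (h : ∀ (a : α) (i : ℕ) (s : Store), s i = enc a →
      (e i).val s = enc (f a) ∧ (e i).cost s ≤ P.eval (esize a)) : PolyTime f := by
  refine ⟨P + 1, fun i j k => ⟨.assign j (e i), fun a s hs => ?_⟩⟩
  obtain ⟨hval, hcost⟩ := h a i s hs
  exact ⟨_, (Run.assign j hval hcost).mono (by simp), Function.update_self ..,
    fun l _ hl => Function.update_of_ne hl ..⟩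

theorem of_enc_eq {f : α → β} (hf : PolyTime f) {g : γ → δ} (i : γ → α)
    (hi : ∀ c, enc (i c) = enc c) (hg : ∀ c, enc (f (i c)) = enc (g c)) : PolyTime g := by
  refine hf.imp fun P hP k l m => (hP k l m).imp fun p hp c s hs => ?_
  simpa only [esize, hi, hg] using hp (i c) s (hs.trans (hi c).symm)

theorem enc_iff {f : α → β} : PolyTime (fun a => enc (f a)) ↔ PolyTime f := Iff.rfl

theorem const (b : β) : PolyTime fun _ : α => b := by
  have key (x : SExp) : ∃ (e : Expr) (n : ℕ), ∀ s, e.val s = x ∧ e.cost s = n := by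
    induction x with
    | nil => exact ⟨.nil, 1, fun s => ⟨rfl, rfl⟩⟩
    | cons x y hx hy =>
      obtain ⟨e, n, he⟩ := hx
      obtain ⟨e', n', he'⟩ := hy
      exact ⟨.cons e e', n + n' + (SExp.cons x y).size, fun s => by
        simp only [Expr.val, Expr.cost, he, he', and_self]⟩
  obtain ⟨e, n, he⟩ := key (enc b)
  exact of_expr (fun _ => e) n fun _ _ s _ => ⟨(he s).1, by simpa using (he s).2.le⟩

theorem hd : PolyTime SExp.hd :=
  of_expr (fun i => .hd (.var i)) (2 * Polynomial.X) fun a i s hs => by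
    have := a.size_hd_le
    simp only [Expr.val, Expr.cost, hs, esize, Polynomial.eval_mul, Polynomial.eval_X,
      Polynomial.eval_ofNat, enc, id_eq, true_and]
    omega

theorem tl : PolyTime SExp.tl :=
  of_expr (fun i => .tl (.var i)) (2 * Polynomial.X) fun a i s hs => by
    have := a.size_tl_le
    simp only [Expr.val, Expr.cost, hs, esize, Polynomial.eval_mul, Polynomial.eval_X,
      Polynomial.eval_ofNat, enc, id_eq, true_and]
    omega

theorem fst : PolyTime fun p : α × β => p.1 := hd.of_enc_eq enc (fun _ => rfl) fun _ => rfl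

theorem snd : PolyTime fun p : α × β => p.2 := tl.of_enc_eq enc (fun _ => rfl) fun _ => rfl

theorem decide_fst_eq_snd [DecidableEq α] : PolyTime fun p : α × α => decide (p.1 = p.2) :=
  of_expr (fun i => .eq (.hd (.var i)) (.tl (.var i))) (4 * Polynomial.X + 3)
    fun ⟨a, b⟩ i s hs => by
    have hcost := esize_bool_le (decide (a = b))
    have hval : (Expr.eq (.hd (.var i)) (.tl (.var i))).val s = enc (decide (a = b)) := by
      simp only [Expr.val, hs, enc_pair, SExp.hd, SExp.tl, enc_injective.eq_iff]
      by_cases h : a = b <;> simp [h, enc_true, enc_false]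
    refine ⟨hval, ?_⟩
    rw [Expr.cost, hval, size_enc]
    simp only [Expr.cost, Expr.val, hs, enc_pair, SExp.hd, SExp.tl, SExp.size, size_enc,
      esize_pair, Polynomial.eval_add, Polynomial.eval_mul, Polynomial.eval_X,
      Polynomial.eval_ofNat]
    omega

theorem comp {f : β → γ} {g : α → β} (hf : PolyTime f) (hg : PolyTime g) :
    PolyTime fun a => f (g a) := by
  obtain ⟨R, hR⟩ := hg.exists_esize_le
  obtain ⟨P, hP⟩ := hf
  obtain ⟨Q, hQ⟩ := hg
  refine ⟨Q + P.comp R, fun i j k => ?_⟩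
  obtain ⟨q, hq⟩ := hQ i k k
  obtain ⟨p, hp⟩ := hP k j k
  refine ⟨.seq q p, fun a s hs => ?_⟩
  obtain ⟨s₁, hrun₁, hout₁, hkeep₁⟩ := hq a s hs
  obtain ⟨s₂, hrun₂, hout₂, hkeep₂⟩ := hp (g a) s₁ hout₁
  refine ⟨s₂, (hrun₁.seq hrun₂).mono ?_, hout₂,
    fun l hl hlj => (hkeep₂ l hl hlj).trans (hkeep₁ l hl hl.ne)⟩
  rw [Polynomial.eval_add, Polynomial.eval_comp]
  exact Nat.add_le_add_left (monotone_eval_nat P (hR a)) _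

theorem pair {f : α → β} {g : α → γ} (hf : PolyTime f) (hg : PolyTime g) :
    PolyTime fun a => (f a, g a) := by
  obtain ⟨Rf, hRf⟩ := hf.exists_esize_le
  obtain ⟨Rg, hRg⟩ := hg.exists_esize_le
  obtain ⟨P, hP⟩ := hf
  obtain ⟨Q, hQ⟩ := hg
  refine ⟨P + (Q + (2 * Rf + 2 * Rg + 2)), fun i j k => ?_⟩
  obtain ⟨r, hir, hkr⟩ : ∃ r, i < r ∧ k ≤ r := ⟨max (i + 1) k, by omega, by omega⟩
  obtain ⟨p, hp⟩ := hP i r r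
  obtain ⟨q, hq⟩ := hQ i (r + 1) (r + 1)
  refine ⟨.seq p (.seq q (.assign j (.cons (.var r) (.var (r + 1))))), fun a s hs => ?_⟩
  obtain ⟨s₁, hrun₁, hout₁, hkeep₁⟩ := hp a s hs
  obtain ⟨s₂, hrun₂, hout₂, hkeep₂⟩ := hq a s₁ ((hkeep₁ i hir hir.ne).trans hs)
  have hr : s₂ r = enc (f a) := (hkeep₂ r (by omega) (by omega)).trans hout₁
  have hval : (Expr.cons (.var r) (.var (r + 1))).val s₂ = enc (f a, g a) := by
    rw [enc_pair, ← hr, ← hout₂, Expr.val, Expr.val, Expr.val]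
  have hcost : (Expr.cons (.var r) (.var (r + 1))).cost s₂
      ≤ 2 * Rf.eval (esize a) + 2 * Rg.eval (esize a) + 1 := by
    have := hRf a
    have := hRg a
    rw [Expr.cost, hval, size_enc, esize_pair, Expr.cost, Expr.cost, hr, hout₂, size_enc, size_enc]
    omega
  refine ⟨_, (hrun₁.seq (hrun₂.seq (Run.assign j hval hcost))).mono ?_,
    Function.update_self .., fun l hl hlj => ?_⟩
  · simp only [Polynomial.eval_add, Polynomial.eval_mul, Polynomial.eval_ofNat]
    omega
  · rw [Function.update_of_ne hlj, hkeep₂ l (by omega) (by omega), hkeep₁ l (by omega) (by omega)]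

theorem ite {c : α → Bool} {f g : α → β} (hc : PolyTime c) (hf : PolyTime f) (hg : PolyTime g) :
    PolyTime fun a => if c a then f a else g a := by
  obtain ⟨P, hP⟩ := hc
  obtain ⟨Q, hQ⟩ := hf
  obtain ⟨R, hR⟩ := hg
  refine ⟨P + (4 + (Q + R)), fun i j k => ?_⟩
  obtain ⟨r, hir, hkr⟩ : ∃ r, i < r ∧ k ≤ r := ⟨max (i + 1) k, by omega, by omega⟩
  obtain ⟨p, hp⟩ := hP i r r
  obtain ⟨q, hq⟩ := hQ i j k
  obtain ⟨q', hq'⟩ := hR i j k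
  refine ⟨.seq p (.ite (.var r) q q'), fun a s hs => ?_⟩
  obtain ⟨s₁, hrun₁, hout₁, hkeep₁⟩ := hp a s hs
  have hs₁ : s₁ i = enc a := (hkeep₁ i hir hir.ne).trans hs
  have hcost : (Expr.var r).cost s₁ ≤ 3 := (congrArg SExp.size hout₁).trans_le (esize_bool_le _)
  have hkeep {s₂ : Store} (h : ∀ l < k, l ≠ j → s₂ l = s₁ l) (l : ℕ) (hl : l < k) (hlj : l ≠ j) :
      s₂ l = s l := (h l hl hlj).trans (hkeep₁ l (by omega) (by omega))
  simp only [Polynomial.eval_add, Polynomial.eval_ofNat]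
  cases h : c a with
  | true =>
    obtain ⟨s₂, hrun₂, hout₂, hkeep₂⟩ := hq a s₁ hs₁
    have htest : (Expr.var r).val s₁ ≠ SExp.nil := by simp [Expr.val, hout₁, h, enc_true]
    exact ⟨s₂, (hrun₁.seq (hrun₂.ite_true htest)).mono (by omega), hout₂, hkeep hkeep₂⟩
  | false =>
    obtain ⟨s₂, hrun₂, hout₂, hkeep₂⟩ := hq' a s₁ hs₁
    have htest : (Expr.var r).val s₁ = SExp.nil := by simp [Expr.val, hout₁, h, enc_false]
    exact ⟨s₂, (hrun₁.seq (hrun₂.ite_false htest)).mono (by omega), hout₂, hkeep hkeep₂⟩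

end PolyTime

end Computes

section Foldl

variable {α β γ : Type*} [Enc α] [Enc β] [Enc γ]

/-- The body of a loop that folds a function, computed by `p` from the variable `r + 2` to `r`,
over the list in the variable `r + 1`. The accumulator is in `r`, and a parameter in `i`. -/
def foldBody (p : Prog) (i r : ℕ) : Prog :=
  .seq (.assign (r + 2) (.cons (.var i) (.cons (.var r) (.hd (.var (r + 1))))))
    (.seq p (.assign (r + 1) (.tl (.var (r + 1)))))

variable {step : α → γ → β → γ} {P : Polynomial ℕ} {p : Prog} {i r : ℕ}

theorem Run.foldBody
    (hp : Computes p (r + 2) r (r + 2) (fun q : α × γ × β => step q.1 q.2.1 q.2.2) P)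
    {x : α} {c : γ} {b : β} {l : List β} {B : ℕ} {s : Store} (hx : s i = enc x) (hc : s r = enc c)
    (hl : s (r + 1) = enc (b :: l)) (hxB : esize x ≤ B) (hcB : esize c ≤ B)
    (hlB : esize (b :: l) ≤ B) :
    ∃ s' : Store, Run (foldBody p i r) s (P.eval (3 * B + 2) + 11 * B + 2) s' ∧
      s' r = enc (step x c b) ∧ s' (r + 1) = enc l ∧ ∀ k < r, s' k = s k := by
  rw [esize_cons] at hlB
  have hcost₁ : (Expr.cons (.var i) (.cons (.var r) (.hd (.var (r + 1))))).cost s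
      ≤ 9 * B := by
    simp only [Expr.cost, Expr.val, hx, hc, hl, enc_cons, SExp.hd, SExp.size, size_enc]
    omega
  have hrun₁ := Run.assign (v := enc (x, c, b)) (r + 2)
    (by simp only [Expr.val, hx, hc, hl, enc_pair, enc_cons, SExp.hd]) hcost₁
  obtain ⟨s₁, hrun₂, hout, hkeep⟩ := hp (x, c, b) _ (Function.update_self ..)
  replace hkeep (k : ℕ) (hk : k < r + 2) (hkr : k ≠ r) : s₁ k = s k :=
    (hkeep k hk hkr).trans (Function.update_of_ne hk.ne ..)
  have hl₁ : s₁ (r + 1) = enc (b :: l) := (hkeep _ (by omega) (by omega)).trans hl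
  have hcost₃ : (Expr.tl (.var (r + 1))).cost s₁ ≤ 2 * B := by
    simp only [Expr.cost, Expr.val, hl₁, enc_cons, SExp.tl, SExp.size, size_enc]
    omega
  have hrun₃ := Run.assign (v := enc l) (r + 1)
    (by simp only [Expr.val, hl₁, enc_cons, SExp.tl]) hcost₃
  have hstep : P.eval (esize (x, c, b)) ≤ P.eval (3 * B + 2) :=
    monotone_eval_nat P (by rw [esize_pair, esize_pair]; omega)
  refine ⟨_, (hrun₁.seq (hrun₂.seq hrun₃)).mono (by omega), ?_, Function.update_self ..,
    fun k hk => ?_⟩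
  · rw [Function.update_of_ne (by omega), hout]
  · rw [Function.update_of_ne (by omega), hkeep k (by omega) hk.ne]

theorem Run.foldLoop (hir : i < r)
    (hp : Computes p (r + 2) r (r + 2) (fun q : α × γ × β => step q.1 q.2.1 q.2.2) P)
    {x : α} {B : ℕ} (hxB : esize x ≤ B) (l : List β) (c : γ) (s : Store) (hx : s i = enc x)
    (hc : s r = enc c) (hl : s (r + 1) = enc l) (hlB : esize l ≤ B)
    (hacc : ∀ l', l' <+: l → esize (l'.foldl (step x) c) ≤ B) :
    ∃ s' : Store, Run (.loop (.var (r + 1)) (ParamComplexity.foldBody p i r)) s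
        (l.length * (P.eval (3 * B + 2) + 12 * B + 3) + B + 1) s' ∧
      s' r = enc (l.foldl (step x) c) ∧ ∀ k < r, s' k = s k := by
  have hcost : (Expr.var (r + 1)).cost s ≤ B := (congrArg SExp.size hl).trans_le hlB
  induction l generalizing c s with
  | nil =>
    refine ⟨s, (Run.loop_false ?_).mono ?_, hc, fun _ _ => rfl⟩
    · exact hl
    · omega
  | cons b l ih =>
    obtain ⟨s₁, hrun₁, hout, hl₁, hkeep₁⟩ :=
      Run.foldBody hp hx hc hl hxB (hacc [] List.nil_prefix) hlB
    have hlB' : esize l ≤ B := by rw [esize_cons] at hlB; omega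
    obtain ⟨s₂, hrun₂, hout₂, hkeep₂⟩ := ih (step x c b) s₁ ((hkeep₁ i hir).trans hx) hout hl₁
      hlB' (fun l' hl' => hacc (b :: l') (List.cons_prefix_cons.mpr ⟨rfl, hl'⟩))
      ((congrArg SExp.size hl₁).trans_le hlB')
    have htest : (Expr.var (r + 1)).val s ≠ SExp.nil := by
      rw [Expr.val, hl, enc_cons]; exact SExp.noConfusion
    refine ⟨s₂, (hrun₁.loop_true htest hrun₂).mono ?_, hout₂,
      fun k hk => (hkeep₂ k hk).trans (hkeep₁ k hk)⟩
    rw [List.length_cons, add_mul, one_mul]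
    omega

theorem PolyTime.foldl {init : α → γ} {lst : α → List β} (B : Polynomial ℕ)
    (hstep : PolyTime fun p : α × γ × β => step p.1 p.2.1 p.2.2) (hinit : PolyTime init)
    (hlst : PolyTime lst)
    (hB : ∀ x l, l <+: lst x → esize (l.foldl (step x) (init x)) ≤ B.eval (esize x)) :
    PolyTime fun x => (lst x).foldl (step x) (init x) := by
  obtain ⟨R, hR⟩ := hlst.exists_esize_le
  obtain ⟨P, hP⟩ := hstep
  obtain ⟨Q, hQ⟩ := hinit
  obtain ⟨Q', hQ'⟩ := hlst
  let M : Polynomial ℕ := B + R + Polynomial.X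
  refine ⟨Q + (Q' + (M * (P.comp (3 * M + 2) + 12 * M + 3) + M + 1 + (M + 1))), fun i j k => ?_⟩
  obtain ⟨r, hir, hkr⟩ : ∃ r, i < r ∧ k ≤ r := ⟨max (i + 1) k, by omega, by omega⟩
  obtain ⟨p, hp⟩ := hP (r + 2) r (r + 2)
  obtain ⟨q, hq⟩ := hQ i r r
  obtain ⟨q', hq'⟩ := hQ' i (r + 1) (r + 1)
  refine ⟨.seq q (.seq q' (.seq (.loop (.var (r + 1)) (foldBody p i r)) (.assign j (.var r)))),
    fun a s hs => ?_⟩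
  obtain ⟨s₁, hrun₁, hout₁, hkeep₁⟩ := hq a s hs
  have hs₁ : s₁ i = enc a := (hkeep₁ i hir hir.ne).trans hs
  obtain ⟨s₂, hrun₂, hout₂, hkeep₂⟩ := hq' a s₁ hs₁
  have hM : M.eval (esize a) = B.eval (esize a) + R.eval (esize a) + esize a := by simp [M]
  have hlstM : esize (lst a) ≤ M.eval (esize a) := by have := hR a; omega
  obtain ⟨s₃, hrun₃, hout₃, hkeep₃⟩ := Run.foldLoop hir hp (hM ▸ Nat.le_add_left ..) (lst a)
    (init a) s₂ ((hkeep₂ i (by omega) (by omega)).trans hs₁)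
    ((hkeep₂ r (by omega) (by omega)).trans hout₁) hout₂ hlstM
    fun l' hl' => (hB a l' hl').trans (by omega)
  have hcost : (Expr.var r).cost s₃ ≤ M.eval (esize a) :=
    (congrArg SExp.size hout₃).trans_le ((hB a _ List.prefix_rfl).trans (by omega))
  refine ⟨_, (hrun₁.seq (hrun₂.seq (hrun₃.seq (Run.assign (e := .var r) j hout₃ hcost)))).mono ?_,
    Function.update_self .., fun l hl hlj => ?_⟩
  · simp only [Polynomial.eval_add, Polynomial.eval_mul, Polynomial.eval_comp,
      Polynomial.eval_ofNat, Polynomial.eval_one]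
    gcongr
    exact (length_le_esize _).trans hlstM
  · rw [Function.update_of_ne hlj, hkeep₃ l (by omega), hkeep₂ l (by omega) (by omega),
      hkeep₁ l (by omega) (by omega)]

end Foldl

/-! ### Polynomial time functions on Booleans, lists and numbers -/

namespace PolyTime

variable {α β γ : Type*} [Enc α] [Enc β] [Enc γ]

theorem congr {f g : α → β} (hf : PolyTime f) (h : ∀ a, g a = f a) : PolyTime g :=
  funext h ▸ hf

theorem decide_eq [DecidableEq β] {f g : α → β} (hf : PolyTime f) (hg : PolyTime g) :
    PolyTime fun a => decide (f a = g a) :=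
  decide_fst_eq_snd.comp (hf.pair hg)

section Bool

variable {f g : α → Bool}

theorem not (hf : PolyTime f) : PolyTime fun a => !f a :=
  (hf.ite (const false) (const true)).congr fun a => by cases f a <;> rfl

theorem and (hf : PolyTime f) (hg : PolyTime g) : PolyTime fun a => f a && g a :=
  (hf.ite hg (const false)).congr fun a => by cases f a <;> rfl

theorem or (hf : PolyTime f) (hg : PolyTime g) : PolyTime fun a => f a || g a :=
  (hf.ite (const true) hg).congr fun a => by cases f a <;> rfl

theorem xor (hf : PolyTime f) (hg : PolyTime g) : PolyTime fun a => f a ^^ g a :=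
  (hf.ite hg.not hg).congr fun a => by cases f a <;> cases g a <;> rfl

end Bool

section List

variable {f g : α → List β}

theorem cons {b : α → β} (hb : PolyTime b) (hf : PolyTime f) : PolyTime fun a => b a :: f a :=
  (hb.pair hf).of_enc_eq id (fun _ => rfl) fun _ => rfl

theorem singleton {b : α → β} (hb : PolyTime b) : PolyTime fun a => [b a] :=
  hb.cons (const [])

theorem isEmpty (hf : PolyTime f) : PolyTime fun a => (f a).isEmpty :=
  (decide_eq (enc_iff.mpr hf) (const SExp.nil)).congr fun a => by
    cases f a <;> simp [enc_nil, enc_cons]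

theorem tail (hf : PolyTime f) : PolyTime fun a => (f a).tail :=
  (tl.comp (enc_iff.mpr hf)).of_enc_eq id (fun _ => rfl) fun a => by
    cases h : f a <;> simp only [id, h] <;> rfl

theorem headD (hf : PolyTime f) (b : β) : PolyTime fun a => (f a).headD b :=
  enc_iff.mp ((hf.isEmpty.ite (const (enc b)) (hd.comp (enc_iff.mpr hf))).congr fun a => by
    cases f a <;> rfl)

theorem reverse (hf : PolyTime f) : PolyTime fun a => (f a).reverse := by
  obtain ⟨R, hR⟩ := hf.exists_esize_le
  have hfold (l : List β) : l.foldl (fun acc b => b :: acc) [] = l.reverse := by simp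
  refine (foldl (step := fun _ acc b => b :: acc) (init := fun _ => []) R
    ((snd.comp snd).cons (fst.comp snd)) (const []) hf fun a l hl => ?_).congr
    fun a => (hfold _).symm
  rw [hfold, esize_reverse]
  exact (esize_le_of_prefix hl).trans (hR a)

theorem append (hf : PolyTime f) (hg : PolyTime g) : PolyTime fun a => f a ++ g a := by
  obtain ⟨R, hR⟩ := hf.exists_esize_le
  obtain ⟨S, hS⟩ := hg.exists_esize_le
  have hfold (l l' : List β) : l.foldl (fun acc b => b :: acc) l' = l.reverse ++ l' := by simp
  refine (foldl (step := fun _ acc b => b :: acc) (R + S)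
    ((snd.comp snd).cons (fst.comp snd)) hg hf.reverse fun a l hl => ?_).congr
    fun a => by rw [hfold, List.reverse_reverse]
  have happend := esize_append l.reverse (g a)
  have hprefix := esize_le_of_prefix hl
  rw [esize_reverse] at happend hprefix
  have := hR a
  have := hS a
  rw [hfold, Polynomial.eval_add]
  omega

theorem flatMap {h : α → β → List γ} (hf : PolyTime f)
    (hh : PolyTime fun p : α × β => h p.1 p.2) : PolyTime fun a => (f a).flatMap (h a) := by
  obtain ⟨R, hR⟩ := hf.exists_esize_le
  obtain ⟨S, hS⟩ := hh.exists_esize_le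
  have hfold (h : β → List γ) (l : List β) (l' : List γ) :
      l.foldl (fun acc b => acc ++ h b) l' = l' ++ l.flatMap h := by
    induction l generalizing l' with
    | nil => rw [List.foldl_nil, List.flatMap_nil, List.append_nil]
    | cons b l ih => rw [List.foldl_cons, ih, List.flatMap_cons, List.append_assoc]
  refine (foldl (step := fun a acc b => acc ++ h a b) (init := fun _ => [])
    (R * S.comp (Polynomial.X + R + 1) + 1)
    ((fst.comp snd).append (hh.comp (fst.pair (snd.comp snd)))) (const []) hf
    fun a l hl => ?_).congr fun a => by rw [hfold, List.nil_append]
  have hlen : l.length ≤ R.eval (esize a) :=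
    (length_le_esize l).trans ((esize_le_of_prefix hl).trans (hR a))
  have hsize : ∀ b ∈ l, esize (h a b) ≤ S.eval (esize a + R.eval (esize a) + 1) := fun b hb => by
    have hbR : esize b ≤ R.eval (esize a) := (esize_le_of_mem (hl.subset hb)).trans (hR a)
    refine (hS (a, b)).trans (monotone_eval_nat S ?_)
    rw [esize_pair]
    omega
  rw [hfold, List.nil_append]
  simp only [Polynomial.eval_add, Polynomial.eval_mul, Polynomial.eval_comp, Polynomial.eval_X,
    Polynomial.eval_one]
  exact (esize_flatMap_le l hsize).trans (by gcongr)

theorem map {h : α → β → γ} (hf : PolyTime f) (hh : PolyTime fun p : α × β => h p.1 p.2) :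
    PolyTime fun a => (f a).map (h a) :=
  (flatMap (h := fun a b => [h a b]) hf hh.singleton).congr fun _ => List.map_eq_flatMap

theorem filter {p : α → β → Bool} (hf : PolyTime f) (hp : PolyTime fun q : α × β => p q.1 q.2) :
    PolyTime fun a => (f a).filter (p a) :=
  (flatMap (h := fun a b => if p a b then [b] else []) hf
    (hp.ite snd.singleton (const []))).congr fun a => by
    induction f a with
    | nil => rfl
    | cons b l ih => cases h : p a b <;> simp [h, ih]

theorem all {p : α → β → Bool} (hf : PolyTime f) (hp : PolyTime fun q : α × β => p q.1 q.2) :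
    PolyTime fun a => (f a).all (p a) :=
  (filter (p := fun a b => !p a b) hf hp.not).isEmpty.congr fun a => by
    induction f a with
    | nil => rfl
    | cons b l ih => cases h : p a b <;> simp [h, ih]

theorem length (hf : PolyTime f) : PolyTime fun a => (f a).length :=
  (map (h := fun _ _ => ()) hf (const ())).of_enc_eq id (fun _ => rfl) fun a => by
    rw [enc_nat, List.map_const', id]

theorem replicate_unit {n : α → ℕ} (hn : PolyTime n) :
    PolyTime fun a => List.replicate (n a) () :=
  hn.of_enc_eq id (fun _ => rfl) fun _ => enc_nat _

theorem drop {n : α → ℕ} (hf : PolyTime f) (hn : PolyTime n) :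
    PolyTime fun a => (f a).drop (n a) := by
  obtain ⟨R, hR⟩ := hf.exists_esize_le
  have hfold (u : List Unit) (l : List β) :
      u.foldl (fun acc _ => acc.tail) l = l.drop u.length := by
    induction u generalizing l with
    | nil => rfl
    | cons _ u ih => rw [List.foldl_cons, ih, List.drop_tail, List.length_cons]
  refine (foldl (step := fun _ acc _ => acc.tail) R (fst.comp snd).tail hf hn.replicate_unit
    fun a u _ => ?_).congr fun a => by rw [hfold, List.length_replicate]
  rw [hfold]
  exact (esize_le_of_suffix (List.drop_suffix ..)).trans (hR a)

theorem getD {n : α → ℕ} (hf : PolyTime f) (hn : PolyTime n) (b : β) :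
    PolyTime fun a => (f a).getD (n a) b :=
  ((hf.drop hn).headD b).congr fun a => by
    rw [List.getD_eq_getElem?_getD, List.headD_eq_head?_getD, List.head?_drop]

end List

section Nat

variable {f g : α → ℕ}

theorem add (hf : PolyTime f) (hg : PolyTime g) : PolyTime fun a => f a + g a :=
  (hf.replicate_unit.append hg.replicate_unit).length.congr fun a => by simp

theorem mul (hf : PolyTime f) (hg : PolyTime g) : PolyTime fun a => f a * g a :=
  (flatMap (h := fun a _ => List.replicate (g a) ()) hf.replicate_unit
    (hg.replicate_unit.comp fst)).length.congr fun a => by simp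

theorem sub (hf : PolyTime f) (hg : PolyTime g) : PolyTime fun a => f a - g a :=
  (hf.replicate_unit.drop hg).length.congr fun a => by simp

theorem decide_lt (hf : PolyTime f) (hg : PolyTime g) : PolyTime fun a => decide (f a < g a) :=
  ((hg.sub hf).decide_eq (const 0)).not.congr fun a => by
    rw [← decide_not]
    exact decide_eq_decide.mpr (by omega)

theorem range (hf : PolyTime f) : PolyTime fun a => List.range (f a) := by
  obtain ⟨R, hR⟩ := hf.exists_esize_le
  have hfold (u : List Unit) :
      u.foldl (fun acc _ => acc ++ [acc.length]) [] = List.range u.length := by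
    induction u using List.reverseRecOn with
    | nil => rfl
    | append_singleton u _ ih => simp [ih, List.range_succ]
  refine (foldl (step := fun _ acc _ => acc ++ [acc.length]) (init := fun _ => [])
    (R * (2 * R + 2) + 1) ((fst.comp snd).append (fst.comp snd).length.singleton)
    (const []) hf.replicate_unit fun a u hu => ?_).congr
    fun a => by rw [hfold, List.length_replicate]
  have hlen : u.length ≤ R.eval (esize a) := by
    have hu' := hu.length_le
    have hfa := hR a
    rw [List.length_replicate] at hu'
    rw [esize_nat] at hfa
    omega
  rw [hfold]
  simp only [Polynomial.eval_add, Polynomial.eval_mul, Polynomial.eval_ofNat, Polynomial.eval_one]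
  exact (esize_range_le _).trans (by gcongr)

end Nat

end PolyTime

/-! ### Parameterized reductions followed by polynomial time reductions -/

theorem exists_eval_le_mul_pow (P : Polynomial ℕ) :
    ∃ A d : ℕ, ∀ n, 0 < n → P.eval n ≤ A * n ^ d := by
  refine ⟨P.eval 1, P.natDegree, fun n hn => ?_⟩
  simp only [Polynomial.eval_eq_sum_range, one_pow, mul_one, Finset.sum_mul]
  gcongr with i hi
  exact Nat.lt_succ_iff.mp (Finset.mem_range.mp hi)

theorem primrec_pow_const (d : ℕ) : Primrec fun n : ℕ => n ^ d := by
  induction d with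
  | zero => exact Primrec.const 1
  | succ d ih => simp only [pow_succ]; exact Primrec.nat_mul.comp ih Primrec.id

theorem computable_add_mul_pow {f : ℕ → ℕ} (hf : Computable f) (A d : ℕ) :
    Computable fun k => f k + A * (f k + 2 * k + 3) ^ d := by
  have h : Primrec fun p : ℕ × ℕ => p.1 + A * (p.1 + 2 * p.2 + 3) ^ d :=
    Primrec.nat_add.comp Primrec.fst (Primrec.nat_mul.comp (Primrec.const A)
      ((primrec_pow_const d).comp (Primrec.nat_add.comp (Primrec.nat_add.comp Primrec.fst
        (Primrec.nat_mul.comp (Primrec.const 2) Primrec.snd)) (Primrec.const 3))))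
  exact h.to_comp.comp (hf.pair Computable.id)

theorem Outputs.size_le {p : Prog} {x y : SExp} {k l t F c : ℕ}
    (h : Outputs p (pair x k) t (pair y l)) (ht : t ≤ F * x.size ^ c) :
    esize (y, l) ≤ (F + 2 * k + 3) * x.size ^ (c + 1) := by
  obtain ⟨s, hs, hs0⟩ := h
  have hx := x.size_pos
  calc esize (y, l) = (s 0).size := by rw [hs0]; rfl
    _ ≤ (inputStore (pair x k) 0).size + t := hs.size_le 0
    _ = x.size + (2 * k + 1) + 1 + t := by rw [← esize_nat]; rfl
    _ ≤ x.size ^ (c + 1) * 1 + (2 * k + 2) * x.size ^ (c + 1) + F * x.size ^ (c + 1) := by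
      have hself : x.size ≤ x.size ^ (c + 1) := Nat.le_self_pow (by omega) _
      have htime : F * x.size ^ c ≤ F * x.size ^ (c + 1) := by gcongr; omega
      have hparam : 2 * k + 2 ≤ (2 * k + 2) * x.size ^ (c + 1) :=
        Nat.le_mul_of_pos_right _ (pow_pos hx _)
      omega
    _ = (F + 2 * k + 3) * x.size ^ (c + 1) := by ring

theorem FPTReducible.trans_polyTime {A B C : ParamProblem} (h : FPTReducible A B)
    {R : SExp × ℕ → SExp × ℕ} (hR : PolyTime R) {r : ℕ → ℕ} (hr : Computable r)
    (hk : ∀ a, (R a).2 ≤ r a.2) (hmono : Monotone r) (hiff : ∀ a, a ∈ B ↔ R a ∈ C) :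
    FPTReducible A C := by
  obtain ⟨p, f, g, c, hf, hg, hp⟩ := h
  obtain ⟨P, hP⟩ := hR
  obtain ⟨q, hq⟩ := hP 0 0 0
  obtain ⟨K, d, hKd⟩ := exists_eval_le_mul_pow P
  refine ⟨.seq p q, fun k => f k + K * (f k + 2 * k + 3) ^ d, fun k => r (g k),
    c + (c + 1) * d, computable_add_mul_pow hf K d, hr.comp hg, fun x k => ?_⟩
  obtain ⟨x', k', t, hout, ht, hk', hA⟩ := hp x k
  have hsize : esize (x', k') ≤ (f k + 2 * k + 3) * x.size ^ (c + 1) := hout.size_le ht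
  obtain ⟨s, hs, hs0⟩ := hout
  obtain ⟨s', ⟨t', ht', hs'⟩, hs0', -⟩ := hq (x', k') s hs0
  refine ⟨(R (x', k')).1, (R (x', k')).2, t + t', ⟨s', hs.seq hs', hs0'⟩, ?_,
    (hk _).trans (hmono hk'), hA.trans (hiff _)⟩
  have hx := x.size_pos
  calc t + t' ≤ f k * x.size ^ c + K * ((f k + 2 * k + 3) * x.size ^ (c + 1)) ^ d := by
        gcongr
        exact ht'.trans ((hKd _ (esize_pos _)).trans (by gcongr))
    _ = f k * x.size ^ c + K * (f k + 2 * k + 3) ^ d * x.size ^ ((c + 1) * d) := by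
        rw [mul_pow, ← pow_mul, mul_assoc]
    _ ≤ f k * x.size ^ (c + (c + 1) * d)
          + K * (f k + 2 * k + 3) ^ d * x.size ^ (c + (c + 1) * d) := by
        gcongr <;> omega
    _ = (f k + K * (f k + 2 * k + 3) ^ d) * x.size ^ (c + (c + 1) * d) := (add_mul ..).symm

/-! ### Isolating vertices attached to a clique -/

section Cover

variable {α : Type*} [DecidableEq α]

/-- Whether the set `S` contains all entries of the list `T`. -/
def covers (S : Finset α) (T : List α) : Bool := T.all fun u => decide (u ∈ S)

theorem covers_iff {S : Finset α} {T : List α} : covers S T = true ↔ ∀ u ∈ T, u ∈ S := by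
  simp only [covers, List.all_eq_true, decide_eq_true_eq]

/-- The number of members of the family `H`, counted with multiplicity, that `S` covers. -/
def coverCount (H : List (List α)) (S : Finset α) : ℕ := H.countP (covers S)

theorem coverCount_eq_card (H : List (List α)) (S : Finset α) :
    coverCount H S = (Finset.univ.filter fun i : Fin H.length => covers S H[i]).card := by
  rw [Finset.card_filter]
  refine Eq.trans ?_ (Fin.sum_univ_fun_getElem H fun T => if covers S T then 1 else 0).symm
  induction H with
  | nil => rfl
  | cons T H ih =>
    simp only [coverCount, List.countP_cons, List.map_cons, List.sum_cons, ← ih, add_comm]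

end Cover

theorem ncard_connectedPairs {V : Type} {G : SimpleGraph V} {C R : Finset V}
    (hRC : ∀ v ∈ R, v ∉ C) (hadj : ∀ u v, u ∉ C → v ∉ C → G.Adj u v → u ∈ R)
    (hconn : ∀ u (hu : u ∈ R) v (hv : v ∈ R),
      (G.induce {v | v ∉ C}).Reachable ⟨u, hRC u hu⟩ ⟨v, hRC v hv⟩) :
    (connectedPairs G C).ncard = R.card * (R.card - 1) := by
  classical
  have mem_of_reachable {p q : {v | v ∉ C}} (hpq : p ≠ q)
      (h : (G.induce {v | v ∉ C}).Reachable p q) : p.val ∈ R := by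
    obtain ⟨walk⟩ := h
    cases walk with
    | nil => exact absurd rfl hpq
    | @cons _ r _ hpr _ => exact hadj _ _ p.2 r.2 hpr
  have image_eq : Prod.map Subtype.val Subtype.val '' connectedPairs G C = (R.offDiag : Set _) := by
    ext ⟨u, v⟩
    simp only [Set.mem_image, connectedPairs, Set.mem_ofPred_eq, Prod.exists, Prod.map_apply,
      Prod.mk.injEq, Finset.coe_offDiag, Set.mem_offDiag, Finset.mem_coe]
    constructor
    · rintro ⟨p, q, ⟨hpq, h⟩, rfl, rfl⟩
      exact ⟨mem_of_reachable hpq h, mem_of_reachable hpq.symm h.symm, Subtype.val_injective.ne hpq⟩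
    · rintro ⟨hu, hv, huv⟩
      exact ⟨_, _, ⟨fun h => huv (congrArg Subtype.val h), hconn u hu v hv⟩, rfl, rfl⟩
  rw [← Set.ncard_image_of_injective _ (Subtype.val_injective.prodMap Subtype.val_injective),
    image_eq, Set.ncard_coe_finset, Finset.offDiag_card, Nat.mul_sub_one]

/-- The simple graph on `n` vertices whose edges are listed by `E`. -/
def graphOf (n : ℕ) (E : List (ℕ × ℕ)) : SimpleGraph (Fin n) :=
  SimpleGraph.fromRel fun u v => (u.val, v.val) ∈ E

theorem encGraph_eq_enc {n : ℕ} (E : List (Fin n × Fin n)) (x : ℕ) :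
    encGraph E x = enc (n, E.map (Prod.map Fin.val Fin.val), x) := by
  simp only [encGraph, enc, List.map_map]
  rfl

theorem listsEdges_iff_eq_graphOf {n : ℕ} {G : SimpleGraph (Fin n)} {E : List (Fin n × Fin n)}
    (hE : ∀ e ∈ E, e.1 ≠ e.2) :
    ListsEdges G E ↔ G = graphOf n (E.map (Prod.map Fin.val Fin.val)) := by
  have mem_map (u v : Fin n) : (u.val, v.val) ∈ E.map (Prod.map Fin.val Fin.val) ↔ (u, v) ∈ E :=
    List.mem_map_of_injective (Fin.val_injective.prodMap Fin.val_injective) (a := (u, v))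
  have ne_of_mem {u v : Fin n} (h : (u, v) ∈ E ∨ (v, u) ∈ E) : u ≠ v :=
    h.elim (hE _) fun h => (hE _ h).symm
  simp only [SimpleGraph.ext_iff, funext_iff, eq_iff_iff, graphOf, SimpleGraph.fromRel_adj, mem_map,
    ListsEdges, and_iff_right_of_imp ne_of_mem]

theorem mem_criticalNodeCut_iff {n : ℕ} {E : List (ℕ × ℕ)} {x k : ℕ}
    (hE : ∀ e ∈ E, e.1 < n ∧ e.2 < n ∧ e.1 ≠ e.2) :
    (enc (n, E, x), k) ∈ criticalNodeCut ↔ HasCriticalNodeCut (graphOf n E) k x := by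
  constructor
  · rintro ⟨m, G, F, y, hGF, henc, hcut⟩
    rw [encGraph_eq_enc] at henc
    obtain ⟨rfl, rfl, rfl⟩ : n = m ∧ E = F.map (Prod.map Fin.val Fin.val) ∧ x = y := by
      simpa only [Prod.mk.injEq] using enc_injective henc
    rwa [← (listsEdges_iff_eq_graphOf fun e he heq =>
      (hE _ (List.mem_map_of_mem he)).2.2 (congrArg Fin.val heq)).mp hGF]
  · intro hcut
    obtain ⟨F, rfl⟩ : ∃ F : List (Fin n × Fin n), F.map (Prod.map Fin.val Fin.val) = E :=
      ⟨E.pmap (fun e (he : e.1 < n ∧ e.2 < n) => (⟨e.1, he.1⟩, ⟨e.2, he.2⟩))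
        fun e he => ⟨(hE e he).1, (hE e he).2.1⟩, by simp [List.map_pmap]⟩
    exact ⟨n, _, F, x, (listsEdges_iff_eq_graphOf fun e he heq =>
      (hE _ (List.mem_map_of_mem he)).2.2 (congrArg Fin.val heq)).mpr rfl,
      (encGraph_eq_enc F x).symm, hcut⟩

/-- The edges of a graph that makes covered lists visible as isolated vertices: a clique on the
vertices below `c`, and for each index `i` of `H` one more vertex `c + i`, which is attached to the
entries of the list `H[i]`. -/
def cliqueEdges (c : ℕ) (H : List (List ℕ)) : List (ℕ × ℕ) :=
  ((List.range c).flatMap fun u => ((List.range c).filter fun v => !decide (u = v)).map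
    fun v => (u, v)) ++
  (List.range H.length).flatMap fun i => (H.getD i []).map fun u => (u, c + i)

theorem mem_cliqueEdges {c : ℕ} {H : List (List ℕ)} {u v : ℕ} :
    (u, v) ∈ cliqueEdges c H ↔
      (u < c ∧ v < c ∧ u ≠ v) ∨ ∃ i : Fin H.length, v = c + i ∧ u ∈ H[i] := by
  simp only [cliqueEdges, List.mem_append, List.mem_flatMap, List.mem_map, List.mem_filter,
    List.mem_range, Prod.mk.injEq, Fin.exists_iff]
  refine or_congr ⟨?_, ?_⟩ (exists_congr fun i => ⟨?_, ?_⟩)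
  · rintro ⟨u, hu, v, ⟨hv, huv⟩, rfl, rfl⟩
    exact ⟨hu, hv, by simpa using huv⟩
  · rintro ⟨hu, hv, huv⟩
    exact ⟨u, hu, v, ⟨hv, by simpa using huv⟩, rfl, rfl⟩
  · rintro ⟨hi, u, hu, rfl, rfl⟩
    exact ⟨hi, rfl, by rwa [List.getD_eq_getElem _ _ hi] at hu⟩
  · rintro ⟨hi, rfl, hu⟩
    exact ⟨hi, u, by rwa [List.getD_eq_getElem _ _ hi], rfl, rfl⟩

/-- The graph with the edges `cliqueEdges c H`. -/
abbrev cliqueGraph (c : ℕ) (H : List (List ℕ)) : SimpleGraph (Fin (c + H.length)) :=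
  graphOf (c + H.length) (cliqueEdges c H)

section Clique

variable {c : ℕ} {H : List (List ℕ)}

theorem cliqueEdges_lt (hH : ∀ T ∈ H, ∀ u ∈ T, u < c) :
    ∀ e ∈ cliqueEdges c H, e.1 < c + H.length ∧ e.2 < c + H.length ∧ e.1 ≠ e.2 := by
  rintro ⟨u, v⟩ he
  dsimp only
  obtain ⟨hu, hv, huv⟩ | ⟨i, rfl, hu⟩ := mem_cliqueEdges.mp he
  · omega
  · have := hH _ (List.getElem_mem i.isLt) u hu
    omega

theorem cliqueGraph_adj_castAdd_castAdd {u v : Fin c} :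
    (cliqueGraph c H).Adj (u.castAdd _) (v.castAdd _) ↔ u ≠ v := by
  simp only [graphOf, SimpleGraph.fromRel_adj, mem_cliqueEdges, Fin.val_castAdd, ne_eq,
    Fin.castAdd_inj, Fin.val_inj]
  grind

theorem cliqueGraph_adj_natAdd_iff (hH : ∀ T ∈ H, ∀ u ∈ T, u < c) {v : Fin (c + H.length)}
    {i : Fin H.length} : (cliqueGraph c H).Adj v (i.natAdd c) ↔ v.val ∈ H[i] := by
  have lt_of_mem {u : ℕ} {j : Fin H.length} (hu : u ∈ H[j]) : u < c :=
    hH _ (List.getElem_mem j.isLt) u hu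
  simp only [graphOf, SimpleGraph.fromRel_adj, mem_cliqueEdges, Fin.val_natAdd, ne_eq, Fin.ext_iff]
  constructor
  · rintro ⟨-, (⟨-, hi, -⟩ | ⟨j, hj, hv⟩) | ⟨hi, -⟩ | ⟨j, -, hi⟩⟩
    · omega
    · rwa [show i = j by omega]
    · omega
    · have := lt_of_mem hi
      omega
  · intro hv
    have := lt_of_mem hv
    exact ⟨by omega, .inl (.inr ⟨i, rfl, hv⟩)⟩

/-- The indices of the attached vertices that remain when `C` is removed from `cliqueGraph c H`, but
lose all their neighbours. -/
def isolated (c : ℕ) (H : List (List ℕ)) (C : Finset (Fin (c + H.length))) :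
    Finset (Fin H.length) :=
  Finset.univ.filter fun i => i.natAdd c ∉ C ∧ covers (C.image Fin.val) H[i]

/-- The vertices that remain when `C` is removed from `cliqueGraph c H`, except for those which the
removal isolates. -/
def giant (c : ℕ) (H : List (List ℕ)) (C : Finset (Fin (c + H.length))) :
    Finset (Fin (c + H.length)) :=
  Cᶜ \ (isolated c H C).map (Fin.natAddEmb c)

theorem mem_giant {C : Finset (Fin (c + H.length))} {v : Fin (c + H.length)} :
    v ∈ giant c H C ↔
      v ∉ C ∧ ∀ i : Fin H.length, i.natAdd c = v → ∃ u ∈ H[i], u ∉ C.image Fin.val := by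
  simp only [giant, isolated, Finset.mem_sdiff, Finset.mem_compl, Finset.mem_map, Finset.mem_filter,
    Finset.mem_univ, true_and, Fin.natAddEmb_apply, covers_iff]
  refine and_congr_right fun hv => ⟨?_, ?_⟩
  · rintro h i rfl
    by_contra! hi
    exact h ⟨i, ⟨hv, hi⟩, rfl⟩
  · rintro h ⟨i, ⟨-, hi⟩, rfl⟩
    obtain ⟨u, hu, huC⟩ := h i rfl
    exact huC (hi u hu)

theorem mem_giant_of_adj (hH : ∀ T ∈ H, ∀ u ∈ T, u < c) {C : Finset (Fin (c + H.length))}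
    {u v : Fin (c + H.length)} (hu : u ∉ C) (hv : v ∉ C) (huv : (cliqueGraph c H).Adj u v) :
    u ∈ giant c H C := by
  refine mem_giant.mpr ⟨hu, ?_⟩
  rintro i rfl
  refine ⟨v.val, (cliqueGraph_adj_natAdd_iff hH).mp huv.symm, ?_⟩
  rwa [Fin.val_injective.mem_finset_image]

theorem exists_reachable_castAdd (hH : ∀ T ∈ H, ∀ u ∈ T, u < c) {C : Finset (Fin (c + H.length))}
    {v : {v | v ∉ C}} (hv : v.val ∈ giant c H C) :
    ∃ (u : Fin c) (hu : u.castAdd _ ∉ C),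
      ((cliqueGraph c H).induce {v | v ∉ C}).Reachable v ⟨u.castAdd _, hu⟩ := by
  obtain ⟨v, hvC⟩ := v
  cases v using Fin.addCases with
  | left u => exact ⟨u, hvC, .refl _⟩
  | right i =>
    obtain ⟨u, hui, huC⟩ := (mem_giant.mp hv).2 i rfl
    have hu : u < c := hH _ (List.getElem_mem i.isLt) u hui
    refine ⟨⟨u, hu⟩, fun h => huC (Finset.mem_image_of_mem Fin.val h), SimpleGraph.Adj.reachable ?_⟩
    exact ((cliqueGraph_adj_natAdd_iff hH).mpr hui).symm

theorem ncard_connectedPairs_cliqueGraph (hH : ∀ T ∈ H, ∀ u ∈ T, u < c)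
    (C : Finset (Fin (c + H.length))) :
    (connectedPairs (cliqueGraph c H) C).ncard =
      (giant c H C).card * ((giant c H C).card - 1) := by
  refine ncard_connectedPairs (fun v hv => (mem_giant.mp hv).1) (fun _ _ => mem_giant_of_adj hH)
    fun v hv w hw => ?_
  obtain ⟨v', hv'C, hvv'⟩ := exists_reachable_castAdd hH (v := ⟨v, _⟩) hv
  obtain ⟨w', hw'C, hww'⟩ := exists_reachable_castAdd hH (v := ⟨w, _⟩) hw
  refine hvv'.trans (.trans ?_ hww'.symm)
  obtain rfl | hne := eq_or_ne v' w'
  · exact .refl _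
  · exact SimpleGraph.Adj.reachable (cliqueGraph_adj_castAdd_castAdd.mpr hne)

theorem card_add_card_isolated_add_card_giant (C : Finset (Fin (c + H.length))) :
    C.card + (isolated c H C).card + (giant c H C).card = c + H.length := by
  have hsub : (isolated c H C).map (Fin.natAddEmb c) ⊆ Cᶜ := by
    simp only [isolated, Finset.subset_iff, Finset.mem_map, Finset.mem_filter, Finset.mem_compl]
    rintro _ ⟨i, ⟨-, hi, -⟩, rfl⟩
    exact hi
  rw [add_assoc, giant, ← Finset.card_map (Fin.natAddEmb c) (s := isolated c H C),
    add_comm (Finset.card (Finset.map ..)), Finset.card_sdiff_add_card_eq_card hsub,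
    Finset.card_add_card_compl, Fintype.card_fin]

theorem card_isolated_le (C : Finset (Fin (c + H.length))) :
    (isolated c H C).card ≤ coverCount H (C.image Fin.val) := by
  rw [coverCount_eq_card]
  exact Finset.card_le_card (Finset.monotone_filter_right _ fun i _ hi => hi.2)

theorem card_isolated_eq {C : Finset (Fin (c + H.length))} (hC : ∀ v ∈ C, v.val < c) :
    (isolated c H C).card = coverCount H (C.image Fin.val) := by
  rw [coverCount_eq_card, isolated]
  congr 1
  exact Finset.filter_congr fun i _ => and_iff_right fun hi => by simpa using hC _ hi

theorem exists_le_coverCount_of_hasCriticalNodeCut (hH : ∀ T ∈ H, ∀ u ∈ T, u < c) {K θ N : ℕ}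
    (hc : K + 2 ≤ c) (hN : N = c + H.length - (K + θ))
    (h : HasCriticalNodeCut (cliqueGraph c H) K (N * (N - 1))) :
    ∃ S : Finset ℕ, S.card ≤ K ∧ θ ≤ coverCount H S := by
  obtain ⟨C, hCK, hx⟩ := h
  refine ⟨C.image Fin.val, Finset.card_image_le.trans hCK, le_trans ?_ (card_isolated_le C)⟩
  rw [ncard_connectedPairs_cliqueGraph hH] at hx
  have hcard := card_add_card_isolated_add_card_giant C
  have hisolated : (isolated c H C).card ≤ H.length :=
    (card_isolated_le C).trans List.countP_le_length
  have hgiant : (giant c H C).card ≤ N := by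
    by_contra! hlt
    exact hx.not_gt (Nat.mul_lt_mul'' hlt (by omega))
  omega

theorem hasCriticalNodeCut_of_le_coverCount (hH : ∀ T ∈ H, ∀ u ∈ T, u < c) {θ N : ℕ} {S : Finset ℕ}
    (hS : S ⊆ Finset.range c) (hN : N = c + H.length - (S.card + θ)) (h : θ ≤ coverCount H S) :
    HasCriticalNodeCut (cliqueGraph c H) S.card (N * (N - 1)) := by
  obtain ⟨C, rfl⟩ : ∃ C : Finset (Fin (c + H.length)), C.image Fin.val = S := by
    refine ⟨S.attachFin fun u hu => ?_, Finset.image_val_attachFin _⟩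
    have := Finset.mem_range.mp (hS hu)
    omega
  rw [Finset.card_image_of_injective _ Fin.val_injective] at hN ⊢
  refine ⟨C, le_rfl, ?_⟩
  rw [ncard_connectedPairs_cliqueGraph hH]
  have hcard := card_add_card_isolated_add_card_giant C
  have hisolated := card_isolated_eq fun v hv =>
    Finset.mem_range.mp (hS (Finset.mem_image_of_mem Fin.val hv))
  have hgiant : (giant c H C).card ≤ N := by omega
  exact Nat.mul_le_mul hgiant (Nat.sub_le_sub_right hgiant 1)

end Clique

/-! ### Maximizing polynomials over sets of variables -/

section Polynomial

variable {α : Type*}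

/-- All lists of length at most `D` with entries in `U`. -/
def tuples (U : List α) : ℕ → List (List α)
  | 0 => [[]]
  | D + 1 => [] :: U.flatMap fun u => (tuples U D).map fun T => u :: T

theorem mem_tuples {U : List α} {D : ℕ} {T : List α} :
    T ∈ tuples U D ↔ T.length ≤ D ∧ ∀ u ∈ T, u ∈ U := by
  induction D generalizing T with
  | zero => cases T <;> simp [tuples]
  | succ D ih =>
    cases T with
    | nil => simp [tuples]
    | cons t T => simp [tuples, ih, and_left_comm]

theorem nodup_tuples {U : List α} (hU : U.Nodup) (D : ℕ) : (tuples U D).Nodup := by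
  induction D with
  | zero => exact List.nodup_singleton _
  | succ D ih =>
    rw [tuples, List.nodup_cons, List.nodup_flatMap]
    refine ⟨by simp, fun u _ => ih.map fun _ _ h => (List.cons.inj h).2, hU.imp fun huv => ?_⟩
    simp only [Function.onFun, List.disjoint_left, List.mem_map]
    rintro _ ⟨T, -, rfl⟩ ⟨T', -, h⟩
    exact huv (List.cons.inj h).1.symm

variable [DecidableEq α]

/-- A polynomial with integer coefficients in the variables `α`, as a list of monomials, each of
which consists of a sign (`true` for `+`) and a list of variables. -/
abbrev SignedPoly (α : Type*) : Type _ := List (Bool × List α)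

/-- The value of a signed monomial at the indicator function of `S`. -/
def monoVal (S : Finset α) (m : Bool × List α) : ℤ :=
  (if m.1 then 1 else -1) * if covers S m.2 then 1 else 0

/-- The value of a polynomial at the indicator function of `S`. -/
def polyVal (S : Finset α) (p : SignedPoly α) : ℤ := (p.map (monoVal S)).sum

theorem covers_cons (S : Finset α) (u : α) (T : List α) :
    covers S (u :: T) = (decide (u ∈ S) && covers S T) := rfl

theorem covers_append (S : Finset α) (T T' : List α) :
    covers S (T ++ T') = (covers S T && covers S T') := List.all_append

theorem polyVal_nil (S : Finset α) : polyVal S [] = 0 := rfl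

theorem polyVal_cons (S : Finset α) (m : Bool × List α) (p : SignedPoly α) :
    polyVal S (m :: p) = monoVal S m + polyVal S p := List.sum_cons

theorem polyVal_append (S : Finset α) (p q : SignedPoly α) :
    polyVal S (p ++ q) = polyVal S p + polyVal S q := by
  simp only [polyVal, List.map_append, List.sum_append]

theorem polyVal_flatMap {β : Type*} (S : Finset α) (l : List β) (f : β → SignedPoly α) :
    polyVal S (l.flatMap f) = (l.map fun b => polyVal S (f b)).sum := by
  induction l with
  | nil => rfl
  | cons b l ih => rw [List.flatMap_cons, polyVal_append, ih, List.map_cons, List.sum_cons]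

theorem polyVal_map_cons (S : Finset α) (u : α) (p : SignedPoly α) :
    polyVal S (p.map fun m => (m.1, u :: m.2)) = if u ∈ S then polyVal S p else 0 := by
  induction p with
  | nil => simp only [List.map_nil, polyVal_nil, ite_self]
  | cons m p ih =>
    rw [List.map_cons, polyVal_cons, polyVal_cons, ih]
    by_cases hu : u ∈ S <;> simp [monoVal, covers_cons, hu]

theorem polyVal_congr {S S' : Finset α} {p : SignedPoly α}
    (h : ∀ m ∈ p, ∀ u ∈ m.2, (u ∈ S ↔ u ∈ S')) : polyVal S p = polyVal S' p := by
  refine congrArg List.sum (List.map_congr_left fun m hm => ?_)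
  have hcovers : covers S m.2 = covers S' m.2 := by
    rw [Bool.eq_iff_iff, covers_iff, covers_iff]
    exact forall₂_congr (h m hm)
  rw [monoVal, monoVal, hcovers]

/-- The number of lists of length at most `D` with entries in a set of size `s`. -/
def tupleCount (s D : ℕ) : ℕ := ∑ i ∈ Finset.range (D + 1), s ^ i

theorem tupleCount_succ (s D : ℕ) : tupleCount s (D + 1) = s * tupleCount s D + 1 := geom_sum_succ

theorem tupleCount_strictMono (D : ℕ) : StrictMono fun s => tupleCount s (D + 1) := fun s s' h =>
  Finset.sum_lt_sum (fun i _ => Nat.pow_le_pow_left h.le i) ⟨1, by simp, by simpa using h⟩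

theorem coverCount_append (H H' : List (List α)) (S : Finset α) :
    coverCount (H ++ H') S = coverCount H S + coverCount H' S := List.countP_append

theorem coverCount_map_cons (H : List (List α)) (u : α) (S : Finset α) :
    coverCount (H.map fun T => u :: T) S = if u ∈ S then coverCount H S else 0 := by
  by_cases hu : u ∈ S <;> simp [coverCount, List.countP_map, Function.comp_def, covers_cons, hu]

theorem coverCount_tuples {U : List α} (hU : U.Nodup) (D : ℕ) (S : Finset α) :
    coverCount (tuples U D) S = tupleCount (U.toFinset ∩ S).card D := by
  have countP_eq : U.countP (fun u => decide (u ∈ S)) = (U.toFinset ∩ S).card := by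
    rw [List.countP_eq_length_filter, ← List.toFinset_card_of_nodup (hU.filter _),
      List.toFinset_filter]
    simp [Finset.filter_mem_eq_inter]
  have coverCount_flatMap (V : List α) (H : List (List α)) :
      coverCount (V.flatMap fun u => H.map fun T => u :: T) S =
        V.countP (fun u => decide (u ∈ S)) * coverCount H S := by
    induction V with
    | nil => simp [coverCount]
    | cons v V ih =>
      rw [List.flatMap_cons, coverCount_append, ih, coverCount_map_cons, List.countP_cons]
      by_cases hv : v ∈ S <;> simp [hv, add_mul, add_comm]
  induction D with
  | zero => simp [coverCount, tuples, tupleCount, covers]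
  | succ D ih =>
    rw [tuples, tupleCount_succ, ← ih, ← countP_eq, ← coverCount_flatMap]
    exact List.countP_cons_of_pos rfl

/-- A family of lists in which cover counts express the values of the polynomial `M`: a negative
monomial is replaced by all other lists of length at most `D`, so that it contributes its value up
to a term that depends on the size of the covering set only. The additional copy of all lists makes
this term strictly increasing in the size even if there are no negative monomials. -/
def positivize (U : List α) (D : ℕ) (M : SignedPoly α) : List (List α) :=
  (M.flatMap fun m => if m.1 then [m.2] else (tuples U D).filter fun T => !decide (T = m.2)) ++
    tuples U D

/-- The number of negative monomials. -/
def negCount (M : SignedPoly α) : ℕ := M.countP fun m => !m.1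

theorem coverCount_filter_ne {H : List (List α)} (hH : H.Nodup) {T : List α} (hT : T ∈ H)
    (S : Finset α) : (coverCount (H.filter fun T' => !decide (T' = T)) S : ℤ) =
      coverCount H S - if covers S T then 1 else 0 := by
  have hperm : coverCount H S = coverCount (T :: H.erase T) S :=
    (List.perm_cons_erase hT).countP_eq _
  have herase : (H.filter fun T' => !decide (T' = T)) = H.erase T := by
    simp only [hH.erase_eq_filter T, bne, Bool.beq_eq_decide_eq]
  rw [herase, hperm, coverCount, coverCount, List.countP_cons]
  push_cast
  ring

theorem coverCount_positivize {U : List α} (hU : U.Nodup) {D : ℕ} {M : SignedPoly α}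
    (hM : ∀ m ∈ M, m.2 ∈ tuples U D) (S : Finset α) : (coverCount (positivize U D M) S : ℤ) =
      polyVal S M + (negCount M + 1) * tupleCount (U.toFinset ∩ S).card D := by
  rw [positivize, coverCount_append, ← coverCount_tuples hU]
  induction M with
  | nil => simp [coverCount, polyVal_nil, negCount]
  | cons m M ih =>
    have ih := ih fun m' hm' => hM m' (List.mem_cons_of_mem _ hm')
    have hfilter := coverCount_filter_ne (nodup_tuples hU D) (hM m List.mem_cons_self) S
    rw [List.flatMap_cons, coverCount_append, polyVal_cons]
    obtain ⟨_ | _, T⟩ := m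
    · have hneg : negCount ((false, T) :: M) = negCount M + 1 := List.countP_cons_of_pos rfl
      simp only [hneg, Bool.false_eq_true, if_false, monoVal] at hfilter ⊢
      push_cast [hfilter] at ih ⊢
      linarith
    · have hneg : negCount ((true, T) :: M) = negCount M := List.countP_cons_of_neg (by simp)
      have hsingle : (coverCount [T] S : ℤ) = if covers S T then 1 else 0 := by
        simp [coverCount, List.countP_cons]
      simp only [hneg, if_true, monoVal]
      push_cast [hsingle] at ih ⊢
      linarith

theorem le_coverCount_positivize_iff {U : List α} (hU : U.Nodup) {D : ℕ} {M : SignedPoly α}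
    (hM : ∀ m ∈ M, m.2 ∈ tuples U (D + 1)) {S : Finset α} {v s : ℕ} (hv : polyVal S M ≤ v)
    (hs : (U.toFinset ∩ S).card ≤ s) :
    v + (negCount M + 1) * tupleCount s (D + 1) ≤ coverCount (positivize U (D + 1) M) S ↔
      polyVal S M = v ∧ (U.toFinset ∩ S).card = s := by
  zify
  rw [coverCount_positivize hU hM]
  constructor
  · intro h
    have hcard : (U.toFinset ∩ S).card = s := by
      by_contra hne
      have hlt : (tupleCount (U.toFinset ∩ S).card (D + 1) : ℤ) < tupleCount s (D + 1) :=
        mod_cast tupleCount_strictMono D (hs.lt_of_ne hne)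
      have := mul_lt_mul_of_pos_left hlt (show (0 : ℤ) < negCount M + 1 by positivity)
      linarith
    rw [hcard] at h
    exact ⟨by linarith, mod_cast hcard⟩
  · rintro ⟨hv, hs⟩
    rw [hv, Nat.cast_inj.mp hs]

end Polynomial

/-! ### Choosing one of several conjunctions of constraints -/

/-- A constraint is a polynomial of degree at most `D` in the variables below `n` that takes only
the values zero and one at sets. A set satisfies the constraint if the value is one. -/
structure IsConstraint (n D : ℕ) (p : SignedPoly ℕ) : Prop where
  mem_tuples : ∀ m ∈ p, m.2 ∈ tuples (List.range n) D
  polyVal_eq : ∀ S, polyVal S p = 0 ∨ polyVal S p = 1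

/-- A family of conjunctions of constraints is satisfied by `S` if one of its members is. -/
def Holds (S : Finset ℕ) (F : List (List (SignedPoly ℕ))) : Prop :=
  ∃ G ∈ F, ∀ p ∈ G, polyVal S p = 1

theorem IsConstraint.polyVal_le_one {n D : ℕ} {p : SignedPoly ℕ} (hp : IsConstraint n D p)
    (S : Finset ℕ) : polyVal S p ≤ 1 := by
  obtain h | h := hp.polyVal_eq S <;> omega

theorem IsConstraint.polyVal_congr {n D : ℕ} {p : SignedPoly ℕ} (hp : IsConstraint n D p)
    {S S' : Finset ℕ} (h : ∀ u < n, (u ∈ S ↔ u ∈ S')) : polyVal S p = polyVal S' p :=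
  ParamComplexity.polyVal_congr fun m hm u hu =>
    h u (List.mem_range.mp ((ParamComplexity.mem_tuples.mp (hp.mem_tuples m hm)).2 u hu))

/-- The polynomial whose maximum decides whether the family `F` is satisfiable, where `n + i` is a
variable for the choice of the conjunction `i`: writing `y i` for its value, it is
`∑ i, y i * ∑ p ∈ F[i], (p - 1) + 2 * ∑ i, y i - (∑ i, y i) ^ 2`. -/
def choicePoly (n : ℕ) (F : List (List (SignedPoly ℕ))) : SignedPoly ℕ :=
  (List.range F.length).flatMap (fun i => (F.getD i []).flatMap fun p =>
    (p ++ [(false, [])]).map fun m => (m.1, (n + i) :: m.2)) ++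
  ((List.range F.length).flatMap (fun i => [(true, [n + i]), (true, [n + i])]) ++
  (List.range F.length).flatMap fun i => (List.range F.length).map fun j => (false, [n + i, n + j]))

/-- The members of `S` beyond `n`, which choose among `L` alternatives. -/
def selected (n L : ℕ) (S : Finset ℕ) : Finset (Fin L) := Finset.univ.filter fun i => n + i.val ∈ S

theorem mem_selected {n L : ℕ} {S : Finset ℕ} {i : Fin L} : i ∈ selected n L S ↔ n + i.val ∈ S := by
  simp only [selected, Finset.mem_filter, Finset.mem_univ, true_and]

theorem sum_map_range {M : Type*} [AddCommMonoid M] (L : ℕ) (f : ℕ → M) :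
    ((List.range L).map f).sum = ∑ i : Fin L, f i := Finset.sum_range f ▸ rfl

theorem card_selected {R : Type*} [NonAssocSemiring R] (n L : ℕ) (S : Finset ℕ) :
    ((selected n L S).card : R) = ∑ i : Fin L, if n + i.val ∈ S then 1 else 0 := by
  rw [selected, Finset.card_filter]
  push_cast
  rfl

theorem card_range_add_inter (n L : ℕ) (S : Finset ℕ) :
    (Finset.range (n + L) ∩ S).card = (Finset.range n ∩ S).card + (selected n L S).card := by
  rw [← Nat.cast_id (selected n L S).card, card_selected,
    ← Finset.sum_range fun i => if n + i ∈ S then 1 else 0]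
  simp only [← Finset.filter_mem_eq_inter, Finset.card_filter, Finset.sum_range_add]

section Choice

variable {n D : ℕ} {F : List (List (SignedPoly ℕ))}

theorem polyVal_choicePoly (n : ℕ) (F : List (List (SignedPoly ℕ))) (S : Finset ℕ) :
    polyVal S (choicePoly n F) =
      ∑ i ∈ selected n F.length S, (F[i].map fun p => polyVal S p - 1).sum +
        (1 - ((selected n F.length S).card - 1) ^ 2) := by
  have linear (i : ℕ) : polyVal S [(true, [n + i]), (true, [n + i])] =
      2 * if n + i ∈ S then 1 else 0 := by
    by_cases h : n + i ∈ S <;> simp [polyVal, monoVal, covers, h]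
  have quadratic (i j : ℕ) : monoVal S (false, [n + i, n + j]) =
      -((if n + i ∈ S then 1 else 0) * if n + j ∈ S then 1 else 0) := by
    by_cases hi : n + i ∈ S <;> by_cases hj : n + j ∈ S <;> simp [monoVal, covers, hi, hj]
  rw [choicePoly, polyVal_append, polyVal_append]
  simp only [polyVal_flatMap, polyVal_map_cons, polyVal_append, linear, sum_map_range]
  congr 1
  · rw [selected, Finset.sum_filter]
    refine Finset.sum_congr rfl fun i _ => ?_
    rw [List.getD_eq_getElem _ _ i.isLt]
    split_ifs
    · rfl
    · simp
  · simp only [polyVal, List.map_map, Function.comp_def, sum_map_range, quadratic, card_selected,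
      Finset.sum_neg_distrib, ← Finset.mul_sum, ← Finset.sum_mul]
    ring

theorem choicePoly_mem_tuples (hF : ∀ G ∈ F, ∀ p ∈ G, IsConstraint n D p) (hD : 1 ≤ D) :
    ∀ m ∈ choicePoly n F, m.2 ∈ tuples (List.range (n + F.length)) (D + 1) := by
  simp only [choicePoly, List.mem_append, List.mem_flatMap, List.mem_map, List.mem_range]
  rintro m (⟨i, hi, p, hp, m', hm' | hm', rfl⟩ | ⟨i, hi, hm⟩ | ⟨i, hi, j, hj, rfl⟩)
  · rw [List.getD_eq_getElem _ _ hi] at hp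
    obtain ⟨hlen, hlt⟩ := mem_tuples.mp ((hF _ (List.getElem_mem hi) p hp).mem_tuples m' hm')
    simp only [List.mem_range] at hlt
    simp only [mem_tuples, List.length_cons, List.mem_cons, List.mem_range, forall_eq_or_imp]
    exact ⟨by omega, by omega, fun u hu => Nat.lt_add_right _ (hlt u hu)⟩
  · simp [List.mem_singleton.mp hm', mem_tuples, hi]
  · obtain rfl : m = (true, [n + i]) := by simpa using hm
    simp [mem_tuples, hi]
  · simp [mem_tuples, hi, hj, hD]

theorem sum_sub_one_nonpos {G : List (SignedPoly ℕ)} {S : Finset ℕ}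
    (hG : ∀ p ∈ G, polyVal S p ≤ 1) : (G.map fun p => polyVal S p - 1).sum ≤ 0 := by
  rw [← Fin.sum_univ_fun_getElem]
  exact Finset.sum_nonpos fun j _ => sub_nonpos.mpr (hG _ (List.getElem_mem j.isLt))

theorem sum_sub_one_eq_zero_iff {G : List (SignedPoly ℕ)} {S : Finset ℕ}
    (hG : ∀ p ∈ G, polyVal S p ≤ 1) :
    (G.map fun p => polyVal S p - 1).sum = 0 ↔ ∀ p ∈ G, polyVal S p = 1 := by
  rw [← Fin.sum_univ_fun_getElem, Finset.sum_eq_zero_iff_of_nonpos fun j _ =>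
    sub_nonpos.mpr (hG _ (List.getElem_mem j.isLt)), List.forall_mem_iff_getElem]
  simp [sub_eq_zero, Fin.forall_iff]

theorem polyVal_choicePoly_le_one {S : Finset ℕ} (hF : ∀ G ∈ F, ∀ p ∈ G, polyVal S p ≤ 1) :
    polyVal S (choicePoly n F) ≤ 1 := by
  rw [polyVal_choicePoly]
  have := Finset.sum_nonpos fun i (_ : i ∈ selected n F.length S) =>
    sum_sub_one_nonpos (hF _ (List.getElem_mem i.isLt))
  have := sq_nonneg (((selected n F.length S).card : ℤ) - 1)
  linarith!

theorem polyVal_choicePoly_eq_one_iff {S : Finset ℕ} (hF : ∀ G ∈ F, ∀ p ∈ G, polyVal S p ≤ 1) :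
    polyVal S (choicePoly n F) = 1 ↔
      ∃ i : Fin F.length, selected n F.length S = {i} ∧ ∀ p ∈ F[i], polyVal S p = 1 := by
  have hle (i : Fin F.length) : ∀ p ∈ F[i], polyVal S p ≤ 1 := hF _ (List.getElem_mem i.isLt)
  rw [polyVal_choicePoly]
  constructor
  · intro h
    have hsum := Finset.sum_nonpos fun i (_ : i ∈ selected n F.length S) =>
      sum_sub_one_nonpos (hle i)
    have hsq := sq_nonneg (((selected n F.length S).card : ℤ) - 1)
    have hcard : (((selected n F.length S).card : ℤ) - 1) ^ 2 = 0 := by linarith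
    obtain ⟨i, hi⟩ : ∃ i, selected n F.length S = {i} := by
      rw [← Finset.card_eq_one]
      exact_mod_cast sub_eq_zero.mp (pow_eq_zero_iff two_ne_zero |>.mp hcard)
    rw [hcard, hi, Finset.sum_singleton] at h
    exact ⟨i, hi, (sum_sub_one_eq_zero_iff (hle i)).mp (by linarith)⟩
  · rintro ⟨i, hi, hp⟩
    rw [hi, Finset.sum_singleton, (sum_sub_one_eq_zero_iff (hle i)).mpr hp]
    simp

/-- The family of lists whose cover counts express the values of the choice polynomial. -/
def choiceLists (n D : ℕ) (F : List (List (SignedPoly ℕ))) : List (List ℕ) :=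
  positivize (List.range (n + F.length)) (D + 1) (choicePoly n F)

/-- The number of lists inside a set of size `k + 1` that encodes a correct choice. -/
def choiceBound (n D k : ℕ) (F : List (List (SignedPoly ℕ))) : ℕ :=
  1 + (negCount (choicePoly n F) + 1) * tupleCount (k + 1) (D + 1)

theorem lt_of_mem_choiceLists (hF : ∀ G ∈ F, ∀ p ∈ G, IsConstraint n D p) (hD : 1 ≤ D) :
    ∀ T ∈ choiceLists n D F, ∀ u ∈ T, u < n + F.length := by
  suffices choiceLists n D F ⊆ tuples (List.range (n + F.length)) (D + 1) from
    fun T hT u hu => List.mem_range.mp ((mem_tuples.mp (this hT)).2 u hu)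
  refine List.append_subset.mpr ⟨fun T hT => ?_, List.Subset.refl _⟩
  obtain ⟨m, hm, hT⟩ := List.mem_flatMap.mp hT
  split_ifs at hT
  · exact List.mem_singleton.mp hT ▸ choicePoly_mem_tuples hF hD m hm
  · exact List.mem_of_mem_filter hT

theorem choiceBound_le_coverCount_iff (hF : ∀ G ∈ F, ∀ p ∈ G, IsConstraint n D p) (hD : 1 ≤ D)
    {k : ℕ} {S : Finset ℕ} (hS : (Finset.range (n + F.length) ∩ S).card ≤ k + 1) :
    choiceBound n D k F ≤ coverCount (choiceLists n D F) S ↔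
      (Finset.range n ∩ S).card = k ∧
        ∃ i : Fin F.length, selected n F.length S = {i} ∧ ∀ p ∈ F[i], polyVal S p = 1 := by
  have hle : ∀ G ∈ F, ∀ p ∈ G, polyVal S p ≤ 1 := fun G hG p hp => (hF G hG p hp).polyVal_le_one S
  have hiff := le_coverCount_positivize_iff List.nodup_range (choicePoly_mem_tuples hF hD) (v := 1)
    (s := k + 1) (mod_cast polyVal_choicePoly_le_one hle) (by rwa [List.toFinset_range])
  rw [choiceBound, choiceLists, hiff, Nat.cast_one, polyVal_choicePoly_eq_one_iff hle, and_comm,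
    List.toFinset_range, card_range_add_inter]
  refine and_congr_left ?_
  rintro ⟨i, hi, -⟩
  rw [hi, Finset.card_singleton, Nat.add_right_cancel_iff]

theorem exists_holds_of_choiceBound_le (hF : ∀ G ∈ F, ∀ p ∈ G, IsConstraint n D p) (hD : 1 ≤ D)
    {k : ℕ} {S : Finset ℕ} (hS : S.card ≤ k + 1)
    (h : choiceBound n D k F ≤ coverCount (choiceLists n D F) S) :
    ∃ S' ⊆ Finset.range n, S'.card = k ∧ Holds S' F := by
  obtain ⟨hcard, i, -, hp⟩ := (choiceBound_le_coverCount_iff hF hD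
    ((Finset.card_le_card Finset.inter_subset_right).trans hS)).mp h
  refine ⟨Finset.range n ∩ S, Finset.inter_subset_left, hcard, F[i], List.getElem_mem _,
    fun p hpi => ?_⟩
  rw [← hp p hpi]
  exact (hF _ (List.getElem_mem _) p hpi).polyVal_congr fun u hu => by simp [hu]

theorem exists_choiceBound_le_of_holds (hF : ∀ G ∈ F, ∀ p ∈ G, IsConstraint n D p) (hD : 1 ≤ D)
    {S' : Finset ℕ} (hS' : S' ⊆ Finset.range n) (h : Holds S' F) :
    ∃ S ⊆ Finset.range (n + F.length), S.card = S'.card + 1 ∧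
      choiceBound n D S'.card F ≤ coverCount (choiceLists n D F) S := by
  obtain ⟨G, hG, hp⟩ := h
  obtain ⟨i, hi, rfl⟩ := List.mem_iff_getElem.mp hG
  have lt_of_mem {u : ℕ} (hu : u ∈ S') : u < n := Finset.mem_range.mp (hS' hu)
  have hni : n + i ∉ S' := fun h => by have := lt_of_mem h; omega
  have mem_insert_iff {u : ℕ} (hu : u < n) : u ∈ insert (n + i) S' ↔ u ∈ S' := by
    rw [Finset.mem_insert, or_iff_right (by omega)]
  have hselected : selected n F.length (insert (n + i) S') = {⟨i, hi⟩} := by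
    ext j
    have (h : n + j.val ∈ S') : False := by have := lt_of_mem h; omega
    simp only [mem_selected, Finset.mem_insert, Finset.mem_singleton, Fin.ext_iff]
    grind
  have hinter : Finset.range n ∩ insert (n + i) S' = S' := by
    ext u
    rw [Finset.mem_inter, Finset.mem_range]
    exact ⟨fun ⟨hu, h⟩ => (mem_insert_iff hu).mp h,
      fun h => ⟨lt_of_mem h, (mem_insert_iff (lt_of_mem h)).mpr h⟩⟩
  have hcard := Finset.card_insert_of_notMem hni
  refine ⟨insert (n + i) S', ?_, hcard, ?_⟩
  · refine Finset.insert_subset (Finset.mem_range.mpr (by lia)) fun u hu => ?_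
    exact Finset.mem_range.mpr (Nat.lt_add_right _ (lt_of_mem hu))
  · have hle : (Finset.range (n + F.length) ∩ insert (n + i) S').card ≤ S'.card + 1 :=
      (Finset.card_le_card Finset.inter_subset_right).trans hcard.le
    refine (choiceBound_le_coverCount_iff hF hD hle).mpr
      ⟨by rw [hinter], ⟨i, hi⟩, hselected, fun p hpi => ?_⟩
    rw [← hp p hpi]
    exact (hF _ hG p hpi).polyVal_congr fun u hu => mem_insert_iff hu

end Choice

/-! ### Circuits as negated conjunctions -/

theorem foldr_max_map_le_iff {ι : Type*} {l : List ι} {f : ι → ℕ} {d : ℕ} :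
    (l.map f).foldr max 0 ≤ d ↔ ∀ i ∈ l, f i ≤ d := by
  induction l with
  | nil => simp
  | cons a l ih => simp [ih]

namespace Gate

/-- Is the node an input node? -/
def isInput : Gate → Bool
  | inp _ => true
  | _ => false

/-- The variable of an input node; zero for gates. -/
def var : Gate → ℕ
  | inp i => i
  | _ => 0

/-- Does the gate negate its inputs, when written as a possibly negated conjunction? -/
def negIn : Gate → Bool
  | or _ => true
  | _ => false

/-- Does the gate negate its output, when written as a possibly negated conjunction? -/
def negOut : Gate → Bool
  | and _ => false
  | _ => true

variable {g : Gate}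

theorem eq_inp_var (h : g.isInput = true) : g = inp g.var := by
  cases g
  · rfl
  all_goals contradiction

theorem value_of_isInput (h : g.isInput = true) (S : Finset ℕ) (vs : List Bool) :
    g.value S vs = decide (g.var ∈ S) := by
  rw [eq_inp_var h]
  rfl

theorem value_of_not_isInput (h : g.isInput = false) (S : Finset ℕ) (vs : List Bool) :
    g.value S vs = (g.negOut ^^ g.preds.all fun j => g.negIn ^^ vs.getD j false) := by
  cases g with
  | inp i => contradiction
  | not j => simp [value, negOut, negIn, preds]
  | and js => simp [value, negOut, negIn, preds]
  | or js => simp [value, negOut, negIn, preds, List.not_all_eq_any_not]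

theorem depth_of_isInput (h : g.isInput = true) (ds : List ℕ) : g.depth ds = 0 := by
  rw [eq_inp_var h]
  rfl

theorem depth_of_not_isInput (h : g.isInput = false) (ds : List ℕ) :
    g.depth ds = (g.preds.map fun j => ds.getD j 0).foldr max 0 + 1 := by
  cases g
  · contradiction
  all_goals rfl

theorem value_congr (S : Finset ℕ) {vs vs' : List Bool}
    (h : ∀ j ∈ g.preds, vs.getD j false = vs'.getD j false) : g.value S vs = g.value S vs' := by
  cases hg : g.isInput
  · rw [value_of_not_isInput hg, value_of_not_isInput hg]
    congr 1
    rw [Bool.eq_iff_iff, List.all_eq_true, List.all_eq_true]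
    exact forall₂_congr fun j hj => by rw [h j hj]
  · rw [value_of_isInput hg, value_of_isInput hg]

theorem depth_congr {ds ds' : List ℕ} (h : ∀ j ∈ g.preds, ds.getD j 0 = ds'.getD j 0) :
    g.depth ds = g.depth ds' := by
  cases hg : g.isInput
  · rw [depth_of_not_isInput hg, depth_of_not_isInput hg, List.map_congr_left h]
  · rw [depth_of_isInput hg, depth_of_isInput hg]

theorem weft_congr {ws ws' : List ℕ} (h : ∀ j ∈ g.preds, ws.getD j 0 = ws'.getD j 0) :
    g.weft ws = g.weft ws' := by
  rw [weft, weft, List.map_congr_left h]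

end Gate

/-- The node with number `j`; a gate without inputs if there is none. -/
def gateAt (gs : List Gate) (j : ℕ) : Gate := gs.getD j (Gate.and [])

theorem inp_var_gateAt_mem {gs : List Gate} {j : ℕ} (h : (gateAt gs j).isInput = true) :
    Gate.inp (gateAt gs j).var ∈ gs := by
  have hj : j < gs.length := by
    by_contra hj
    rw [gateAt, List.getD_eq_default _ _ (by lia)] at h
    contradiction
  rw [← Gate.eq_inp_var h, gateAt, List.getD_eq_getElem _ _ hj]
  exact List.getElem_mem hj

namespace Circuit

/-- Nodes are fed by earlier nodes only. -/
def Ordered (gs : List Gate) : Prop :=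
  ∀ (i : ℕ) (g : Gate), gs[i]? = some g → ∀ j ∈ g.preds, j < i

theorem ordered_iff {gs : List Gate} :
    Ordered gs ↔ ∀ i < gs.length, ∀ j ∈ (gateAt gs i).preds, j < i := by
  constructor
  · intro h i hi
    exact h i _ (by rw [gateAt, List.getD_eq_getElem _ _ hi, List.getElem?_eq_getElem hi])
  · intro h i g hg
    obtain ⟨hi, rfl⟩ := List.getElem?_eq_some_iff.mp hg
    simpa [gateAt, hi] using h i hi

section Run

variable {β : Type} (step : List β → Gate → β)

theorem run_concat (gs : List Gate) (g : Gate) :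
    run step (gs ++ [g]) = run step gs ++ [step (run step gs) g] := List.foldl_concat ..

theorem length_run (gs : List Gate) : (run step gs).length = gs.length := by
  induction gs using List.reverseRecOn with
  | nil => rfl
  | append_singleton gs g ih => simp [run_concat, ih]

theorem run_prefix_run_append (gs gs' : List Gate) : run step gs <+: run step (gs ++ gs') := by
  induction gs' using List.reverseRecOn with
  | nil => simp
  | append_singleton gs' g ih =>
    rw [← List.append_assoc, run_concat]
    exact ih.trans (List.prefix_append ..)

theorem run_take (gs : List Gate) {i : ℕ} (hi : i ≤ gs.length) :
    run step (gs.take i) = (run step gs).take i := by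
  have h := run_prefix_run_append step (gs.take i) (gs.drop i)
  rw [List.take_append_drop, List.prefix_iff_eq_take, length_run, List.length_take_of_le hi] at h
  exact h

theorem getD_run {d : β}
    (hstep : ∀ {g vs vs'}, (∀ j ∈ Gate.preds g, vs.getD j d = vs'.getD j d) →
      step vs g = step vs' g)
    {gs : List Gate} (hgs : Ordered gs) {i : ℕ} (hi : i < gs.length) :
    (run step gs).getD i d = step (run step gs) (gateAt gs i) := by
  have htake : (run step gs).take (i + 1) =
      (run step gs).take i ++ [step ((run step gs).take i) (gateAt gs i)] := by
    rw [← run_take step gs hi, List.take_succ_eq_append_getElem hi, run_concat,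
      run_take step gs hi.le, gateAt, List.getD_eq_getElem _ _ hi]
  have hlen : i < (run step gs).length := by rwa [length_run]
  rw [List.take_succ_eq_append_getElem hlen, List.append_cancel_left_eq,
    List.singleton_inj] at htake
  rw [List.getD_eq_getElem _ _ hlen, htake]
  refine hstep fun j hj => ?_
  rw [List.getD_eq_getElem?_getD, List.getElem?_take_of_lt (ordered_iff.mp hgs i hi j hj),
    List.getD_eq_getElem?_getD]

theorem getLastD_run (d : β) (gs : List Gate) :
    (run step gs).getLastD d = (run step gs).getD (gs.length - 1) d := by
  rw [List.getLastD_eq_getLast?, List.getLast?_eq_getElem?, List.getD_eq_getElem?_getD, length_run]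

end Run

/-- The value of the node `j`. -/
def nodeVal (gs : List Gate) (S : Finset ℕ) (j : ℕ) : Bool :=
  (run (Gate.value S) gs).getD j false

/-- The depth of the node `j`. -/
def nodeDepth (gs : List Gate) (j : ℕ) : ℕ := (run Gate.depth gs).getD j 0

/-- The weft of the node `j`. -/
def nodeWeft (gs : List Gate) (j : ℕ) : ℕ := (run Gate.weft gs).getD j 0

theorem eval_eq_nodeVal (C : Circuit) (S : Finset ℕ) :
    C.eval S = nodeVal C.gates S (C.gates.length - 1) := getLastD_run ..

theorem depth_eq_nodeDepth (C : Circuit) : C.depth = nodeDepth C.gates (C.gates.length - 1) :=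
  getLastD_run ..

theorem weft_eq_nodeWeft (C : Circuit) : C.weft = nodeWeft C.gates (C.gates.length - 1) :=
  getLastD_run ..

section Node

variable {gs : List Gate} {j : ℕ}

theorem nodeVal_of_isInput (hgs : Ordered gs) (hj : j < gs.length)
    (h : (gateAt gs j).isInput = true) (S : Finset ℕ) :
    nodeVal gs S j = decide ((gateAt gs j).var ∈ S) := by
  rw [nodeVal, getD_run _ (Gate.value_congr S) hgs hj, Gate.value_of_isInput h]

theorem nodeVal_of_not_isInput (hgs : Ordered gs) (hj : j < gs.length)
    (h : (gateAt gs j).isInput = false) (S : Finset ℕ) :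
    nodeVal gs S j = ((gateAt gs j).negOut ^^
      (gateAt gs j).preds.all fun i => (gateAt gs j).negIn ^^ nodeVal gs S i) := by
  rw [nodeVal, getD_run _ (Gate.value_congr S) hgs hj, Gate.value_of_not_isInput h]
  rfl

theorem nodeVal_eq_iff (hgs : Ordered gs) (hj : j < gs.length)
    (h : (gateAt gs j).isInput = false) (S : Finset ℕ) (b : Bool) :
    nodeVal gs S j = b ↔ if b ^^ (gateAt gs j).negOut
      then ∀ i ∈ (gateAt gs j).preds, nodeVal gs S i = !(gateAt gs j).negIn
      else ∃ i ∈ (gateAt gs j).preds, nodeVal gs S i = (gateAt gs j).negIn := by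
  rw [nodeVal_of_not_isInput hgs hj h]
  generalize (gateAt gs j).negIn = c
  cases b <;> cases (gateAt gs j).negOut <;> cases c <;> simp

theorem nodeDepth_le_zero_iff (hgs : Ordered gs) (hj : j < gs.length) :
    nodeDepth gs j ≤ 0 ↔ (gateAt gs j).isInput = true := by
  rw [nodeDepth, getD_run _ Gate.depth_congr hgs hj]
  cases h : (gateAt gs j).isInput
  · simp [Gate.depth_of_not_isInput h]
  · simp [Gate.depth_of_isInput h]

theorem nodeDepth_le_succ_iff (hgs : Ordered gs) (hj : j < gs.length)
    (h : (gateAt gs j).isInput = false) {d : ℕ} :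
    nodeDepth gs j ≤ d + 1 ↔ ∀ i ∈ (gateAt gs j).preds, nodeDepth gs i ≤ d := by
  rw [nodeDepth, getD_run _ Gate.depth_congr hgs hj, Gate.depth_of_not_isInput h,
    Nat.add_le_add_iff_right, foldr_max_map_le_iff]
  rfl

theorem nodeWeft_of_isInput (hgs : Ordered gs) (hj : j < gs.length)
    (h : (gateAt gs j).isInput = true) : nodeWeft gs j = 0 := by
  rw [nodeWeft, getD_run _ Gate.weft_congr hgs hj, Gate.eq_inp_var h]
  rfl

theorem nodeWeft_le_iff (hgs : Ordered gs) (hj : j < gs.length) {w : ℕ} :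
    nodeWeft gs j ≤ w ↔ if (gateAt gs j).IsLarge
      then 0 < w ∧ ∀ i ∈ (gateAt gs j).preds, nodeWeft gs i ≤ w - 1
      else ∀ i ∈ (gateAt gs j).preds, nodeWeft gs i ≤ w := by
  rw [nodeWeft, getD_run _ Gate.weft_congr hgs hj, Gate.weft]
  simp only [nodeWeft, ← foldr_max_map_le_iff]
  split_ifs <;> lia

end Node

end Circuit

open Circuit

/-- Has the node `j` depth at most `d` and weft at most `w`? -/
def smallNode (gs : List Gate) : ℕ → ℕ → ℕ → Bool
  | 0, _, j => (gateAt gs j).isInput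
  | d + 1, w, j =>
    (gateAt gs j).isInput ||
      if decide (gateAt gs j).IsLarge then
        decide (0 < w) && (gateAt gs j).preds.all fun i => smallNode gs d (w - 1) i
      else (gateAt gs j).preds.all fun i => smallNode gs d w i

theorem smallNode_iff {gs : List Gate} (hgs : Ordered gs) {d w j : ℕ} (hj : j < gs.length) :
    smallNode gs d w j = true ↔ nodeDepth gs j ≤ d ∧ nodeWeft gs j ≤ w := by
  induction d generalizing w j with
  | zero =>
    rw [nodeDepth_le_zero_iff hgs hj, smallNode, iff_self_and]
    exact fun h => (nodeWeft_of_isInput hgs hj h).trans_le w.zero_le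
  | succ d ih =>
    rw [smallNode]
    cases h : (gateAt gs j).isInput
    · have ih (w : ℕ) : (∀ i ∈ (gateAt gs j).preds, smallNode gs d w i = true) ↔
          ∀ i ∈ (gateAt gs j).preds, nodeDepth gs i ≤ d ∧ nodeWeft gs i ≤ w :=
        forall₂_congr fun i hi => ih ((ordered_iff.mp hgs j hj i hi).trans hj)
      rw [nodeDepth_le_succ_iff hgs hj h, nodeWeft_le_iff hgs hj]
      split_ifs <;> simp_all [forall_and, and_left_comm]
    · have hdepth := (nodeDepth_le_zero_iff hgs hj).mpr h
      simp [nodeWeft_of_isInput hgs hj h, Nat.le_zero.mp hdepth]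

/-- Is the circuit well-formed? -/
def isWellFormed (C : Circuit) : Bool :=
  !C.gates.isEmpty && ((List.range C.gates.length).all (fun i =>
    (gateAt C.gates i).preds.all fun j => decide (j < i)) &&
    C.gates.all fun g => !g.isInput || decide (g.var < C.inputs))

theorem isWellFormed_iff (C : Circuit) : isWellFormed C = true ↔ C.WellFormed := by
  rw [WellFormed, ← Ordered, ordered_iff]
  simp only [isWellFormed, Bool.and_eq_true, List.all_eq_true, decide_eq_true_eq, List.mem_range]
  refine and_congr (by simp) (and_congr_right fun _ => ⟨fun h i hi => ?_, fun h g hg => ?_⟩)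
  · exact of_decide_eq_true (h _ hi)
  · cases hinp : g.isInput
    · rfl
    · rw [Gate.eq_inp_var hinp] at hg
      simpa using h _ hg

/-! ### Families of constraints for circuits of weft one -/

section Arithmetic

variable {α : Type*}

/-- One minus the given polynomial. -/
def complPoly (p : SignedPoly α) : SignedPoly α := (true, []) :: p.map fun m => (!m.1, m.2)

/-- The given polynomial, or one minus it. -/
def xorPoly (b : Bool) (p : SignedPoly α) : SignedPoly α := if b then complPoly p else p

/-- The product of two polynomials. -/
def mulPoly (p q : SignedPoly α) : SignedPoly α :=
  p.flatMap fun m => q.map fun m' => (!(m.1 ^^ m'.1), m.2 ++ m'.2)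

variable [DecidableEq α] (S : Finset α)

theorem polyVal_one : polyVal S [(true, [])] = 1 := by simp [polyVal, monoVal, covers]

theorem polyVal_var (u : α) : polyVal S [(true, [u])] = (decide (u ∈ S)).toInt := by
  by_cases h : u ∈ S <;> simp [polyVal, monoVal, covers, h]

theorem polyVal_complPoly (p : SignedPoly α) : polyVal S (complPoly p) = 1 - polyVal S p := by
  have hneg : polyVal S (p.map fun m => (!m.1, m.2)) = -polyVal S p := by
    induction p with
    | nil => rfl
    | cons m p ih =>
      rw [List.map_cons, polyVal_cons, polyVal_cons, ih, neg_add]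
      cases hm : m.1 <;> cases hc : covers S m.2 <;> simp [monoVal, hm, hc]
  rw [complPoly, polyVal_cons, hneg]
  simp [monoVal, covers, sub_eq_add_neg]

theorem monoVal_mul (m m' : Bool × List α) :
    monoVal S (!(m.1 ^^ m'.1), m.2 ++ m'.2) = monoVal S m * monoVal S m' := by
  simp only [monoVal, covers_append]
  cases m.1 <;> cases m'.1 <;> cases covers S m.2 <;> cases covers S m'.2 <;> rfl

theorem polyVal_mulPoly (p q : SignedPoly α) :
    polyVal S (mulPoly p q) = polyVal S p * polyVal S q := by
  rw [mulPoly, polyVal_flatMap]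
  simp only [polyVal, List.map_map, Function.comp_def, monoVal_mul, List.sum_map_mul_left,
    List.sum_map_mul_right]

variable {S}

theorem polyVal_xorPoly (b : Bool) {p : SignedPoly α} {v : Bool} (h : polyVal S p = v.toInt) :
    polyVal S (xorPoly b p) = (b ^^ v).toInt := by
  cases b
  · simpa [xorPoly] using h
  · rw [xorPoly, if_pos rfl, polyVal_complPoly, h]
    cases v <;> rfl

/-- The product of the first two members. Gates that are not large have at most two inputs; the
truncation makes the products computable in polynomial time for all other gates, too. -/
def prodTwo (L : List (SignedPoly α)) : SignedPoly α :=
  mulPoly (L.headD [(true, [])]) (L.tail.headD [(true, [])])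

theorem polyVal_prodTwo {ι : Type*} {l : List ι} (hl : l.length ≤ 2) {q : ι → SignedPoly α}
    {f : ι → Bool} (h : ∀ i ∈ l, polyVal S (q i) = (f i).toInt) :
    polyVal S (prodTwo (l.map q)) = (l.all f).toInt := by
  match l with
  | [] => simp [prodTwo, polyVal_mulPoly, polyVal_one]
  | [a] => simp [prodTwo, polyVal_mulPoly, polyVal_one, h a]
  | [a, b] =>
    simp only [prodTwo, List.map_cons, List.headD_cons, List.tail_cons, polyVal_mulPoly,
      h a (by simp), h b (by simp), List.all_cons, List.all_nil, Bool.and_true]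
    cases f a <;> cases f b <;> rfl

end Arithmetic

namespace IsConstraint

variable {n D D' : ℕ} {p q : SignedPoly ℕ}

theorem mono (hp : IsConstraint n D p) (h : D ≤ D') : IsConstraint n D' p where
  mem_tuples m hm :=
    have := ParamComplexity.mem_tuples.mp (hp.mem_tuples m hm)
    ParamComplexity.mem_tuples.mpr ⟨this.1.trans h, this.2⟩
  polyVal_eq := hp.polyVal_eq

theorem zero : IsConstraint n D [] where
  mem_tuples := by simp
  polyVal_eq _ := .inl rfl

theorem one : IsConstraint n D [(true, [])] where
  mem_tuples := by simp [ParamComplexity.mem_tuples]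
  polyVal_eq _ := .inr (polyVal_one _)

theorem var {i : ℕ} (hi : i < n) : IsConstraint n (D + 1) [(true, [i])] where
  mem_tuples := by simp [ParamComplexity.mem_tuples, hi]
  polyVal_eq S := by
    rw [polyVal_var]
    cases decide (i ∈ S) <;> simp

theorem complPoly (hp : IsConstraint n D p) : IsConstraint n D (complPoly p) where
  mem_tuples := by
    simp only [ParamComplexity.complPoly, List.mem_cons, List.mem_map, forall_eq_or_imp,
      forall_exists_index, and_imp, forall_apply_eq_imp_iff₂]
    exact ⟨by simp [ParamComplexity.mem_tuples], hp.mem_tuples⟩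
  polyVal_eq S := by
    rw [polyVal_complPoly]
    obtain h | h := hp.polyVal_eq S <;> simp [h]

theorem xorPoly (hp : IsConstraint n D p) (b : Bool) : IsConstraint n D (xorPoly b p) := by
  cases b
  · exact hp
  · exact hp.complPoly

theorem mulPoly (hp : IsConstraint n D p) (hq : IsConstraint n D' q) :
    IsConstraint n (D + D') (mulPoly p q) where
  mem_tuples m hm := by
    simp only [ParamComplexity.mulPoly, List.mem_flatMap, List.mem_map] at hm
    obtain ⟨a, ha, b, hb, rfl⟩ := hm
    obtain ⟨hlena, hmema⟩ := ParamComplexity.mem_tuples.mp (hp.mem_tuples a ha)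
    obtain ⟨hlenb, hmemb⟩ := ParamComplexity.mem_tuples.mp (hq.mem_tuples b hb)
    rw [ParamComplexity.mem_tuples, List.length_append, List.forall_mem_append]
    exact ⟨add_le_add hlena hlenb, hmema, hmemb⟩
  polyVal_eq S := by
    rw [polyVal_mulPoly]
    obtain h | h := hp.polyVal_eq S <;> simp [h, hq.polyVal_eq S]

theorem prodTwo {L : List (SignedPoly ℕ)} (hL : ∀ p ∈ L, IsConstraint n D p) :
    IsConstraint n (D + D) (prodTwo L) := by
  have headD {L : List (SignedPoly ℕ)} (hL : ∀ p ∈ L, IsConstraint n D p) :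
      IsConstraint n D (L.headD [(true, [])]) := by
    cases L with
    | nil => exact one
    | cons p L => exact hL p List.mem_cons_self
  exact (headD hL).mulPoly (headD fun p hp => hL p (List.mem_of_mem_tail hp))

end IsConstraint

/-- The constraint that a Boolean quantity with polynomial `p` has the value `b`. -/
def literal (b : Bool) (p : SignedPoly ℕ) : List (List (SignedPoly ℕ)) := [[xorPoly (!b) p]]

/-- The conjunction of the first two families, with the same truncation as in `prodTwo`. -/
def conjTwo (L : List (List (List (SignedPoly ℕ)))) : List (List (SignedPoly ℕ)) :=
  (L.headD [[]]).flatMap fun G => (L.tail.headD [[]]).map fun G' => G ++ G'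

section Holds

variable {S : Finset ℕ}

theorem polyVal_xorPoly_eq_one_iff (b : Bool) {p : SignedPoly ℕ} {v : Bool}
    (h : polyVal S p = v.toInt) : polyVal S (xorPoly b p) = 1 ↔ v = !b := by
  rw [polyVal_xorPoly b h]
  cases b <;> cases v <;> decide

theorem holds_singleton {G : List (SignedPoly ℕ)} : Holds S [G] ↔ ∀ p ∈ G, polyVal S p = 1 := by
  simp [Holds]

theorem holds_literal (b : Bool) {p : SignedPoly ℕ} {v : Bool} (h : polyVal S p = v.toInt) :
    Holds S (literal b p) ↔ v = b := by
  rw [literal, holds_singleton, List.forall_mem_singleton, polyVal_xorPoly_eq_one_iff _ h,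
    Bool.not_not]

theorem holds_flatMap {ι : Type*} {l : List ι} {F : ι → List (List (SignedPoly ℕ))} :
    Holds S (l.flatMap F) ↔ ∃ i ∈ l, Holds S (F i) := by
  simp only [Holds, List.mem_flatMap]
  tauto

theorem holds_conj {A B : List (List (SignedPoly ℕ))} :
    Holds S (A.flatMap fun G => B.map fun G' => G ++ G') ↔ Holds S A ∧ Holds S B := by
  simp only [Holds, List.mem_flatMap, List.mem_map]
  constructor
  · rintro ⟨_, ⟨G, hG, G', hG', rfl⟩, h⟩
    exact ⟨⟨G, hG, (List.forall_mem_append.mp h).1⟩, G', hG', (List.forall_mem_append.mp h).2⟩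
  · rintro ⟨⟨G, hG, h⟩, G', hG', h'⟩
    exact ⟨_, ⟨G, hG, G', hG', rfl⟩, List.forall_mem_append.mpr ⟨h, h'⟩⟩

theorem holds_conjTwo {L : List (List (List (SignedPoly ℕ)))} (hL : L.length ≤ 2) :
    Holds S (conjTwo L) ↔ ∀ F ∈ L, Holds S F := by
  have hnil : Holds S [[]] := by simp [Holds]
  rw [conjTwo, holds_conj]
  match L with
  | [] => simp [hnil]
  | [A] => simp [hnil]
  | [A, B] => simp

theorem forall_mem_conjTwo {P : SignedPoly ℕ → Prop} {L : List (List (List (SignedPoly ℕ)))}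
    (hL : ∀ F ∈ L, ∀ G ∈ F, ∀ p ∈ G, P p) : ∀ G ∈ conjTwo L, ∀ p ∈ G, P p := by
  have headD {L : List (List (List (SignedPoly ℕ)))} (hL : ∀ F ∈ L, ∀ G ∈ F, ∀ p ∈ G, P p) :
      ∀ G ∈ L.headD [[]], ∀ p ∈ G, P p := by
    cases L with
    | nil => simp
    | cons F L => exact hL F List.mem_cons_self
  simp only [conjTwo, List.mem_flatMap, List.mem_map]
  rintro _ ⟨G, hG, G', hG', rfl⟩
  exact List.forall_mem_append.mpr
    ⟨headD hL G hG, headD (fun F hF => hL F (List.mem_of_mem_tail hF)) G' hG'⟩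

end Holds

/-- The polynomial for the value of the node `j`, if it has depth at most `d` and weft zero. -/
def nodePoly (gs : List Gate) : ℕ → ℕ → SignedPoly ℕ
  | 0, j => if (gateAt gs j).isInput then [(true, [(gateAt gs j).var])] else []
  | d + 1, j =>
    if (gateAt gs j).isInput then [(true, [(gateAt gs j).var])]
    else xorPoly (gateAt gs j).negOut
      (prodTwo ((gateAt gs j).preds.map fun i => xorPoly (gateAt gs j).negIn (nodePoly gs d i)))

/-- Conjunctions of constraints, one of which is satisfied if and only if the node `j` has the
value `b`, provided that `j` has depth at most `d` and weft at most one. -/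
def guesses (gs : List Gate) : ℕ → ℕ → Bool → List (List (SignedPoly ℕ))
  | 0, j, b => if (gateAt gs j).isInput then literal b [(true, [(gateAt gs j).var])] else []
  | d + 1, j, b =>
    if (gateAt gs j).isInput then literal b [(true, [(gateAt gs j).var])]
    else if decide (gateAt gs j).IsLarge then
      if b ^^ (gateAt gs j).negOut then
        [(gateAt gs j).preds.map fun i => xorPoly (gateAt gs j).negIn (nodePoly gs d i)]
      else (gateAt gs j).preds.flatMap fun i => literal (gateAt gs j).negIn (nodePoly gs d i)
    else if b ^^ (gateAt gs j).negOut then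
      conjTwo ((gateAt gs j).preds.map fun i => guesses gs d i (!(gateAt gs j).negIn))
    else (gateAt gs j).preds.flatMap fun i => guesses gs d i (gateAt gs j).negIn

section Guesses

variable {gs : List Gate}

theorem isConstraint_var {n D j : ℕ} (hn : ∀ i, Gate.inp i ∈ gs → i < n)
    (h : (gateAt gs j).isInput = true) (hD : 1 ≤ D) :
    IsConstraint n D [(true, [(gateAt gs j).var])] :=
  (IsConstraint.var (D := 0) (hn _ (inp_var_gateAt_mem h))).mono hD

theorem isConstraint_nodePoly {n : ℕ} (hn : ∀ i, Gate.inp i ∈ gs → i < n) (d j : ℕ) :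
    IsConstraint n (2 ^ d) (nodePoly gs d j) := by
  induction d generalizing j with
  | zero =>
    rw [nodePoly]
    split_ifs with h
    · exact isConstraint_var hn h le_rfl
    · exact .zero
  | succ d ih =>
    rw [nodePoly]
    split_ifs with h
    · exact isConstraint_var hn h Nat.one_le_two_pow
    · rw [pow_succ, mul_two]
      refine (IsConstraint.prodTwo ?_).xorPoly _
      exact List.forall_mem_map.mpr fun i _ => (ih i).xorPoly _

theorem isConstraint_of_mem_guesses {n : ℕ} (hn : ∀ i, Gate.inp i ∈ gs → i < n) (d j : ℕ)
    (b : Bool) : ∀ G ∈ guesses gs d j b, ∀ p ∈ G, IsConstraint n (2 ^ d) p := by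
  have literal {D : ℕ} {p : SignedPoly ℕ} (b : Bool) (hp : IsConstraint n D p) :
      ∀ G ∈ literal b p, ∀ p ∈ G, IsConstraint n D p := by
    simpa [ParamComplexity.literal] using hp.xorPoly _
  induction d generalizing j b with
  | zero =>
    rw [guesses]
    split_ifs with h
    · exact literal b (isConstraint_var hn h le_rfl)
    · simp
  | succ d ih =>
    have hpow : 2 ^ d ≤ 2 ^ (d + 1) := Nat.pow_le_pow_right two_pos d.le_succ
    have hpoly (i : ℕ) := (isConstraint_nodePoly hn d i).mono hpow
    have ih (i : ℕ) (b : Bool) : ∀ G ∈ guesses gs d i b, ∀ p ∈ G, IsConstraint n (2 ^ (d + 1)) p :=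
      fun G hG p hp => (ih i b G hG p hp).mono hpow
    rw [guesses]
    split_ifs with h
    · exact literal b (isConstraint_var hn h Nat.one_le_two_pow)
    · exact List.forall_mem_singleton.mpr
        (List.forall_mem_map.mpr fun i _ => (hpoly i).xorPoly _)
    · exact List.forall_mem_flatMap.mpr fun i _ => literal _ (hpoly i)
    · exact forall_mem_conjTwo (List.forall_mem_map.mpr fun i _ => ih i _)
    · exact List.forall_mem_flatMap.mpr fun i _ => ih i _

theorem preds_of_smallNode {d w j : ℕ} (hgs : Ordered gs) (hj : j < gs.length)
    (h : smallNode gs (d + 1) w j = true) (hinp : (gateAt gs j).isInput = false) :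
    if (gateAt gs j).IsLarge
      then 0 < w ∧ ∀ i ∈ (gateAt gs j).preds, i < gs.length ∧ smallNode gs d (w - 1) i = true
      else ∀ i ∈ (gateAt gs j).preds, i < gs.length ∧ smallNode gs d w i = true := by
  have hlt : ∀ i ∈ (gateAt gs j).preds, i < gs.length :=
    fun i hi => (ordered_iff.mp hgs j hj i hi).trans hj
  rw [smallNode, hinp] at h
  split_ifs with hlarge <;> simp_all

theorem polyVal_nodePoly (hgs : Ordered gs) (S : Finset ℕ) {d j : ℕ} (hj : j < gs.length)
    (h : smallNode gs d 0 j = true) : polyVal S (nodePoly gs d j) = (nodeVal gs S j).toInt := by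
  induction d generalizing j with
  | zero =>
    have hinp : (gateAt gs j).isInput = true := h
    rw [nodePoly, if_pos hinp, polyVal_var, nodeVal_of_isInput hgs hj hinp]
  | succ d ih =>
    rw [nodePoly]
    cases hinp : (gateAt gs j).isInput
    · have hpreds := preds_of_smallNode hgs hj h hinp
      rw [if_neg Bool.false_ne_true, nodeVal_of_not_isInput hgs hj hinp]
      split_ifs at hpreds with hlarge
      · exact absurd hpreds.1 (lt_irrefl 0)
      · exact polyVal_xorPoly _ (polyVal_prodTwo (not_lt.mp hlarge) fun i hi =>
          polyVal_xorPoly _ (ih (hpreds i hi).1 (hpreds i hi).2))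
    · rw [if_pos rfl, polyVal_var, nodeVal_of_isInput hgs hj hinp]

theorem holds_guesses_iff (hgs : Ordered gs) (S : Finset ℕ) {d j : ℕ} (hj : j < gs.length)
    (h : smallNode gs d 1 j = true) (b : Bool) :
    Holds S (guesses gs d j b) ↔ nodeVal gs S j = b := by
  have hvar {j : ℕ} (hj : j < gs.length) (hinp : (gateAt gs j).isInput = true) (b : Bool) :
      Holds S (literal b [(true, [(gateAt gs j).var])]) ↔ nodeVal gs S j = b := by
    rw [holds_literal b (polyVal_var S _), nodeVal_of_isInput hgs hj hinp]
  induction d generalizing j b with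
  | zero =>
    have hinp : (gateAt gs j).isInput = true := h
    rw [guesses, if_pos hinp, hvar hj hinp]
  | succ d ih =>
    rw [guesses]
    cases hinp : (gateAt gs j).isInput
    · have hpreds := preds_of_smallNode hgs hj h hinp
      rw [if_neg Bool.false_ne_true, nodeVal_eq_iff hgs hj hinp]
      simp only [decide_eq_true_eq]
      by_cases hlarge : (gateAt gs j).IsLarge
      · have hpoly : ∀ i ∈ (gateAt gs j).preds,
            polyVal S (nodePoly gs d i) = (nodeVal gs S i).toInt := fun i hi =>
          have hi := (if_pos hlarge ▸ hpreds).2 i hi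
          polyVal_nodePoly hgs S hi.1 hi.2
        rw [if_pos hlarge]
        split_ifs
        · rw [holds_singleton, List.forall_mem_map]
          exact forall₂_congr fun i hi => polyVal_xorPoly_eq_one_iff _ (hpoly i hi)
        · rw [holds_flatMap]
          exact exists_congr fun i => and_congr_right fun hi => holds_literal _ (hpoly i hi)
      · have ih (i : ℕ) (hi : i ∈ (gateAt gs j).preds) (b : Bool) :=
          have hi := (if_neg hlarge ▸ hpreds) i hi
          ih hi.1 hi.2 b
        rw [if_neg hlarge]
        split_ifs
        · rw [holds_conjTwo (by simpa using not_lt.mp hlarge), List.forall_mem_map]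
          exact forall₂_congr fun i hi => ih i hi _
        · rw [holds_flatMap]
          exact exists_congr fun i => and_congr_right fun hi => ih i hi _
    · rw [if_pos rfl, hvar hj hinp]

end Guesses

/-! ### The reduction -/

/-- The list with the given encoding. -/
def SExp.toList : SExp → List SExp
  | nil => []
  | cons a l => a :: l.toList

theorem SExp.list_toList (x : SExp) : SExp.list x.toList = x := by
  induction x with
  | nil => rfl
  | cons a l _ ih => rw [toList, list, ih]

theorem SExp.toList_list (l : List SExp) : (SExp.list l).toList = l :=
  SExp.list_injective (SExp.list_toList _)

/-- The number with the given encoding. -/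
def SExp.toNat (x : SExp) : ℕ := x.toList.length

theorem SExp.toNat_num (n : ℕ) : (SExp.num n).toNat = n := by
  induction n with
  | zero => rfl
  | succ n ih => exact congrArg (· + 1) ih

theorem SExp.map_toNat_num (js : List ℕ) : (js.map SExp.num).map SExp.toNat = js :=
  List.map_map.trans (List.map_id'' SExp.toNat_num js)

/-- The node with the given encoding. -/
def Gate.decode (x : SExp) : Gate :=
  if decide (x.hd = SExp.num 0) then inp x.tl.toNat
  else if decide (x.hd = SExp.num 1) then not x.tl.toNat
  else if decide (x.hd = SExp.num 2) then and (x.tl.toList.map SExp.toNat)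
  else or (x.tl.toList.map SExp.toNat)

theorem Gate.decode_enc (g : Gate) : decode g.enc = g := by
  cases g <;> simp only [decode, enc, SExp.hd, SExp.tl, SExp.num_injective.eq_iff, SExp.toNat_num,
    SExp.toList_list, SExp.map_toNat_num] <;> rfl

/-- The circuit with the given encoding. -/
def Circuit.decode (x : SExp) : Circuit := ⟨x.hd.toNat, x.tl.toList.map Gate.decode⟩

theorem Circuit.decode_enc (C : Circuit) : decode C.enc = C := by
  simp only [decode, enc, SExp.hd, SExp.tl, SExp.toNat_num, SExp.toList_list, List.map_map,
    Function.comp_def, Gate.decode_enc, List.map_id']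

instance : Enc Gate := ⟨Gate.enc, Function.LeftInverse.injective Gate.decode_enc⟩

instance : Enc Circuit := ⟨Circuit.enc, Function.LeftInverse.injective Circuit.decode_enc⟩

/-- The instance of Critical Node Cut that asks for a set of `k` variables below `n` satisfying one
of the conjunctions of constraints in `F`, of degree at most `D`. The clique has `k + 3` vertices
beyond the variables, so that no `k + 1` vertices contain all but one vertex of it. -/
def cutInstance (n D k : ℕ) (F : List (List (SignedPoly ℕ))) : SExp × ℕ :=
  let H := choiceLists n D F
  let c := n + F.length + (k + 3)
  let N := c + H.length - (k + 1 + choiceBound n D k F)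
  (enc (c + H.length, cliqueEdges c H, N * (N - 1)), k + 1)

theorem cutInstance_mem_criticalNodeCut_iff {n D k : ℕ} {F : List (List (SignedPoly ℕ))}
    (hF : ∀ G ∈ F, ∀ p ∈ G, IsConstraint n D p) (hD : 1 ≤ D) :
    cutInstance n D k F ∈ criticalNodeCut ↔
      ∃ S ⊆ Finset.range n, S.card = k ∧ Holds S F := by
  have hH : ∀ T ∈ choiceLists n D F, ∀ u ∈ T, u < n + F.length + (k + 3) :=
    fun T hT u hu => (lt_of_mem_choiceLists hF hD T hT u hu).trans_le (Nat.le_add_right ..)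
  rw [cutInstance, mem_criticalNodeCut_iff (cliqueEdges_lt hH)]
  constructor
  · intro hcut
    obtain ⟨S, hS, hcount⟩ := exists_le_coverCount_of_hasCriticalNodeCut hH (by lia) rfl hcut
    exact exists_holds_of_choiceBound_le hF hD hS hcount
  · rintro ⟨S', hS', rfl, hholds⟩
    obtain ⟨S, hS, hcard, hcount⟩ := exists_choiceBound_le_of_holds hF hD hS' hholds
    rw [← hcard]
    exact hasCriticalNodeCut_of_le_coverCount hH
      (hS.trans (Finset.range_subset_range.mpr (Nat.le_add_right ..))) rfl hcount

namespace Circuit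

variable {C : Circuit}

theorem WellFormed.last_lt (hC : C.WellFormed) : C.gates.length - 1 < C.gates.length :=
  Nat.sub_one_lt (List.length_pos_iff.mpr hC.1).ne'

/-- Is the circuit well-formed, of depth at most `h` and weft at most one? -/
def isAdmissible (h : ℕ) (C : Circuit) : Bool :=
  isWellFormed C && smallNode C.gates h 1 (C.gates.length - 1)

theorem isAdmissible_iff {h : ℕ} :
    isAdmissible h C = true ↔ C.WellFormed ∧ C.weft ≤ 1 ∧ C.depth ≤ h := by
  rw [isAdmissible, Bool.and_eq_true, isWellFormed_iff]
  refine and_congr_right fun hC => ?_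
  rw [smallNode_iff hC.2.1 hC.last_lt, ← depth_eq_nodeDepth, ← weft_eq_nodeWeft, and_comm]

/-- Conjunctions of constraints, one of which is satisfied if and only if the circuit is, provided
that it is admissible. -/
def outputGuesses (h : ℕ) (C : Circuit) : List (List (SignedPoly ℕ)) :=
  guesses C.gates h (C.gates.length - 1) true

theorem isConstraint_of_mem_outputGuesses {h : ℕ} (hC : C.WellFormed) :
    ∀ G ∈ outputGuesses h C, ∀ p ∈ G, IsConstraint C.inputs (2 ^ h) p :=
  isConstraint_of_mem_guesses hC.2.2 _ _ _

theorem holds_outputGuesses_iff {h : ℕ} (hC : isAdmissible h C = true) (S : Finset ℕ) :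
    Holds S (outputGuesses h C) ↔ C.eval S = true := by
  rw [isAdmissible, Bool.and_eq_true, isWellFormed_iff] at hC
  rw [outputGuesses, holds_guesses_iff hC.1.2.1 S hC.1.last_lt hC.2, eval_eq_nodeVal]

end Circuit

/-- The reduction from weighted satisfiability of circuits of weft at most one and depth at most
`h` to Critical Node Cut. Invalid inputs are mapped to a word that does not encode a graph. -/
def cutReduction (h : ℕ) (a : SExp × ℕ) : SExp × ℕ :=
  let C := Circuit.decode a.1
  if decide (C.enc = a.1) && C.isAdmissible h
  then cutInstance C.inputs (2 ^ h) a.2 (C.outputGuesses h) else (SExp.nil, 0)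

theorem mem_weightedCircuitSat_iff (h : ℕ) (a : SExp × ℕ) :
    a ∈ weightedCircuitSat 1 h ↔
      ((Circuit.decode a.1).enc = a.1 ∧ (Circuit.decode a.1).isAdmissible h = true) ∧
        ∃ S ⊆ Finset.range (Circuit.decode a.1).inputs, S.card = a.2 ∧
          (Circuit.decode a.1).eval S = true := by
  constructor
  · rintro ⟨C, hwf, hweft, hdepth, ha, hS⟩
    rw [ha, Circuit.decode_enc]
    exact ⟨⟨rfl, isAdmissible_iff.mpr ⟨hwf, hweft, hdepth⟩⟩, hS⟩
  · rintro ⟨⟨ha, hC⟩, hS⟩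
    obtain ⟨hwf, hweft, hdepth⟩ := isAdmissible_iff.mp hC
    exact ⟨_, hwf, hweft, hdepth, ha.symm, hS⟩

theorem nil_notMem_criticalNodeCut (k : ℕ) : (SExp.nil, k) ∉ criticalNodeCut := by
  rintro ⟨n, G, E, x, -, hnil, -⟩
  cases hnil

theorem mem_weightedCircuitSat_iff_cutReduction_mem (h : ℕ) (a : SExp × ℕ) :
    a ∈ weightedCircuitSat 1 h ↔ cutReduction h a ∈ criticalNodeCut := by
  rw [mem_weightedCircuitSat_iff]
  simp only [cutReduction, Bool.and_eq_true, decide_eq_true_eq]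
  split_ifs with hC
  · have hwf := (isAdmissible_iff.mp hC.2).1
    rw [cutInstance_mem_criticalNodeCut_iff (isConstraint_of_mem_outputGuesses hwf)
      Nat.one_le_two_pow]
    simp only [hC, and_self, true_and, holds_outputGuesses_iff hC.2]
  · exact iff_of_false (fun ha => hC ha.1) (nil_notMem_criticalNodeCut 0)

theorem cutReduction_snd_le (h : ℕ) (a : SExp × ℕ) : (cutReduction h a).2 ≤ a.2 + 1 := by
  rw [cutReduction]
  split_ifs
  · exact le_rfl
  · exact Nat.zero_le _

/-! ### The reduction takes polynomial time -/

namespace PolyTime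

variable {α β : Type*} [Enc α] [Enc β]

section Circuits

protected theorem toList {f : α → SExp} (hf : PolyTime f) : PolyTime fun a => (f a).toList :=
  hf.of_enc_eq id (fun _ => rfl) fun a => by
    change f a = SExp.list ((f a).toList.map id)
    rw [List.map_id, SExp.list_toList]

protected theorem toNat {f : α → SExp} (hf : PolyTime f) : PolyTime fun a => (f a).toNat :=
  hf.toList.length

protected theorem mapToNat {f : α → SExp} (hf : PolyTime f) :
    PolyTime fun a => (f a).toList.map SExp.toNat :=
  hf.toList.map snd.toNat

theorem of_enc_eq_cons_num {t : ℕ} {f : α → β} (hf : PolyTime f) {g : α → Gate}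
    (hg : ∀ a, (g a).enc = SExp.cons (SExp.num t) (Enc.enc (f a))) : PolyTime g :=
  ((const t).pair hf).of_enc_eq id (fun _ => rfl) fun a => (hg a).symm

theorem gate_decode : PolyTime Gate.decode :=
  (hd.decide_eq (const _)).ite (tl.toNat.of_enc_eq_cons_num fun _ => rfl)
    ((hd.decide_eq (const _)).ite (tl.toNat.of_enc_eq_cons_num fun _ => rfl)
      ((hd.decide_eq (const _)).ite (tl.mapToNat.of_enc_eq_cons_num fun _ => rfl)
        (tl.mapToNat.of_enc_eq_cons_num fun _ => rfl)))

theorem circuit_decode : PolyTime Circuit.decode :=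
  (hd.toNat.pair (tl.toList.map (h := fun _ => Gate.decode) (gate_decode.comp snd))).of_enc_eq id
    (fun _ => rfl) fun _ => rfl

protected theorem inputs {f : α → Circuit} (hf : PolyTime f) : PolyTime fun a => (f a).inputs :=
  (hd.comp (enc_iff.mpr hf)).of_enc_eq id (fun _ => rfl) fun _ => rfl

protected theorem gates {f : α → Circuit} (hf : PolyTime f) : PolyTime fun a => (f a).gates :=
  (tl.comp (enc_iff.mpr hf)).of_enc_eq id (fun _ => rfl) fun _ => rfl

section Gate

variable {g : α → Gate}

theorem decide_hd_enc_eq (hg : PolyTime g) (t : ℕ) :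
    PolyTime fun a => decide ((g a).enc.hd = SExp.num t) :=
  (hd.comp (enc_iff.mpr hg)).decide_eq (const _)

protected theorem isInput (hg : PolyTime g) : PolyTime fun a => (g a).isInput :=
  (hg.decide_hd_enc_eq 0).congr fun a => by cases g a <;> rfl

protected theorem negIn (hg : PolyTime g) : PolyTime fun a => (g a).negIn :=
  (hg.decide_hd_enc_eq 3).congr fun a => by cases g a <;> rfl

protected theorem negOut (hg : PolyTime g) : PolyTime fun a => (g a).negOut :=
  (hg.decide_hd_enc_eq 2).not.congr fun a => by cases g a <;> rfl

protected theorem var (hg : PolyTime g) : PolyTime fun a => (g a).var :=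
  enc_iff.mp ((hg.isInput.ite (tl.comp (enc_iff.mpr hg)) (const SExp.nil)).congr fun a => by
    cases g a <;> rfl)

protected theorem preds (hg : PolyTime g) : PolyTime fun a => (g a).preds := by
  have htl := tl.comp (enc_iff.mpr hg)
  exact enc_iff.mp ((hg.isInput.ite (const SExp.nil)
    ((hg.decide_hd_enc_eq 1).ite (enc_iff.mpr htl.singleton) htl)).congr fun a => by
      cases g a <;> rfl)

protected theorem decide_isLarge (hg : PolyTime g) : PolyTime fun a => decide (g a).IsLarge :=
  (const 2).decide_lt hg.preds.length

end Gate

protected theorem gateAt {f : α → List Gate} {j : α → ℕ} (hf : PolyTime f) (hj : PolyTime j) :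
    PolyTime fun a => gateAt (f a) (j a) :=
  hf.getD hj _

protected theorem smallNode (d : ℕ) :
    PolyTime fun a : List Gate × ℕ × ℕ => smallNode a.1 d a.2.1 a.2.2 := by
  have hg : PolyTime fun a : List Gate × ℕ × ℕ => gateAt a.1 a.2.2 := fst.gateAt (snd.comp snd)
  induction d with
  | zero => exact hg.isInput
  | succ d ih =>
    have hw : PolyTime fun a : List Gate × ℕ × ℕ => a.2.1 := fst.comp snd
    have hall {w : List Gate × ℕ × ℕ → ℕ} (hw : PolyTime w) : PolyTime fun a =>
        (gateAt a.1 a.2.2).preds.all fun i => smallNode a.1 d (w a) i :=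
      hg.preds.all (ih.comp ((fst.comp fst).pair ((hw.comp fst).pair snd)))
    exact hg.isInput.or (hg.decide_isLarge.ite
      (((const 0).decide_lt hw).and (hall (hw.sub (const 1)))) (hall hw))

protected theorem isWellFormed {C : α → Circuit} (hC : PolyTime C) :
    PolyTime fun a => isWellFormed (C a) := by
  have hordered : PolyTime fun a => (List.range (C a).gates.length).all fun i =>
      (gateAt (C a).gates i).preds.all fun j => decide (j < i) :=
    hC.gates.length.range.all
      (((hC.comp fst).gates.gateAt snd).preds.all (snd.decide_lt (snd.comp fst)))
  have hinputs : PolyTime fun a => (C a).gates.all fun g =>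
      !g.isInput || decide (g.var < (C a).inputs) :=
    hC.gates.all (snd.isInput.not.or (snd.var.decide_lt (hC.comp fst).inputs))
  exact hC.gates.isEmpty.not.and (hordered.and hinputs)

protected theorem isAdmissible {C : α → Circuit} (hC : PolyTime C) (h : ℕ) :
    PolyTime fun a => (C a).isAdmissible h :=
  hC.isWellFormed.and ((PolyTime.smallNode h).comp
    (hC.gates.pair ((const 1).pair (hC.gates.length.sub (const 1)))))

end Circuits

section Polynomials

variable {p q : α → SignedPoly β}

protected theorem complPoly (hp : PolyTime p) : PolyTime fun a => complPoly (p a) :=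
  (const (true, [])).cons (hp.map ((fst.comp snd).not.pair (snd.comp snd)))

protected theorem xorPoly {b : α → Bool} (hb : PolyTime b) (hp : PolyTime p) :
    PolyTime fun a => xorPoly (b a) (p a) :=
  hb.ite hp.complPoly hp

protected theorem mulPoly (hp : PolyTime p) (hq : PolyTime q) :
    PolyTime fun a => mulPoly (p a) (q a) :=
  hp.flatMap ((hq.comp fst).map (((fst.comp (snd.comp fst)).xor (fst.comp snd)).not.pair
    ((snd.comp (snd.comp fst)).append (snd.comp snd))))

protected theorem prodTwo {L : α → List (SignedPoly β)} (hL : PolyTime L) :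
    PolyTime fun a => prodTwo (L a) :=
  (hL.headD _).mulPoly (hL.tail.headD _)

protected theorem conjTwo {L : α → List (List (List (SignedPoly ℕ)))} (hL : PolyTime L) :
    PolyTime fun a => conjTwo (L a) :=
  (hL.headD _).flatMap (((hL.tail.headD _).comp fst).map ((snd.comp fst).append snd))

theorem var_poly {u : α → β} (hu : PolyTime u) :
    PolyTime fun a => ([(true, [u a])] : SignedPoly β) :=
  ((const true).pair hu.singleton).singleton

protected theorem literal {b : α → Bool} {p : α → SignedPoly ℕ} (hb : PolyTime b)
    (hp : PolyTime p) : PolyTime fun a => literal (b a) (p a) :=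
  (hb.not.xorPoly hp).singleton.singleton

protected theorem tuples {U : α → List β} (hU : PolyTime U) (D : ℕ) :
    PolyTime fun a => tuples (U a) D := by
  induction D with
  | zero => exact const [[]]
  | succ D ih => exact (const []).cons (hU.flatMap ((ih.comp fst).map ((snd.comp fst).cons snd)))

protected theorem tupleCount {s : α → ℕ} (hs : PolyTime s) (D : ℕ) :
    PolyTime fun a => tupleCount (s a) D := by
  induction D with
  | zero => exact (const 1).congr fun a => by simp [tupleCount]
  | succ D ih => exact ((hs.mul ih).add (const 1)).congr fun a => tupleCount_succ _ _

protected theorem positivize [DecidableEq β] {U : α → List β} (hU : PolyTime U)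
    (hp : PolyTime p) (D : ℕ) : PolyTime fun a => positivize (U a) D (p a) :=
  (hp.flatMap ((fst.comp snd).ite (snd.comp snd).singleton
    (((hU.tuples D).comp fst).filter (snd.decide_eq (snd.comp (snd.comp fst))).not))).append
    (hU.tuples D)

protected theorem negCount (hp : PolyTime p) : PolyTime fun a => negCount (p a) :=
  (hp.filter (fst.comp snd).not).length.congr fun _ => List.countP_eq_length_filter

end Polynomials

section Guesses

protected theorem nodePoly (d : ℕ) : PolyTime fun a : List Gate × ℕ => nodePoly a.1 d a.2 := by
  have hg : PolyTime fun a : List Gate × ℕ => gateAt a.1 a.2 := fst.gateAt snd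
  induction d with
  | zero => exact hg.isInput.ite hg.var.var_poly (const [])
  | succ d ih =>
    exact hg.isInput.ite hg.var.var_poly (hg.negOut.xorPoly (hg.preds.map
      ((hg.comp fst).negIn.xorPoly (ih.comp ((fst.comp fst).pair snd)))).prodTwo)

protected theorem guesses (d : ℕ) :
    PolyTime fun a : List Gate × ℕ × Bool => guesses a.1 d a.2.1 a.2.2 := by
  have hg : PolyTime fun a : List Gate × ℕ × Bool => gateAt a.1 a.2.1 := fst.gateAt (fst.comp snd)
  have hb : PolyTime fun a : List Gate × ℕ × Bool => a.2.2 := snd.comp snd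
  have hvar := hb.literal hg.var.var_poly
  induction d with
  | zero => exact hg.isInput.ite hvar (const [])
  | succ d ih =>
    have hneg := hg.negIn.comp (fst (β := ℕ))
    have hnode : PolyTime fun q : (List Gate × ℕ × Bool) × ℕ => nodePoly q.1.1 d q.2 :=
      (PolyTime.nodePoly d).comp ((fst.comp fst).pair snd)
    have hguess {b : (List Gate × ℕ × Bool) × ℕ → Bool} (hb : PolyTime b) :
        PolyTime fun q => guesses q.1.1 d q.2 (b q) :=
      ih.comp ((fst.comp fst).pair (snd.pair hb))
    exact hg.isInput.ite hvar (hg.decide_isLarge.ite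
      ((hb.xor hg.negOut).ite (hg.preds.map (hneg.xorPoly hnode)).singleton
        (hg.preds.flatMap (hneg.literal hnode)))
      ((hb.xor hg.negOut).ite (hg.preds.map (hguess hneg.not)).conjTwo
        (hg.preds.flatMap (hguess hneg))))

protected theorem outputGuesses {C : α → Circuit} (hC : PolyTime C) (h : ℕ) :
    PolyTime fun a => (C a).outputGuesses h :=
  (PolyTime.guesses h).comp (hC.gates.pair ((hC.gates.length.sub (const 1)).pair (const true)))

end Guesses

section Reduction

variable {n k : α → ℕ} {F : α → List (List (SignedPoly ℕ))}

protected theorem choicePoly (hn : PolyTime n) (hF : PolyTime F) :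
    PolyTime fun a => choicePoly (n a) (F a) := by
  have hrange := hF.length.range
  have hvar : PolyTime fun q : α × ℕ => n q.1 + q.2 := (hn.comp fst).add snd
  have hchosen : PolyTime fun a => (List.range (F a).length).flatMap fun i =>
      ((F a).getD i []).flatMap fun p =>
        (p ++ [(false, [])]).map fun m => (m.1, (n a + i) :: m.2) :=
    hrange.flatMap (((hF.comp fst).getD snd []).flatMap ((snd.append (const [(false, [])])).map
      ((fst.comp snd).pair ((hvar.comp (fst.comp fst)).cons (snd.comp snd)))))
  have hlinear : PolyTime fun a => (List.range (F a).length).flatMap fun i =>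
      [(true, [n a + i]), (true, [n a + i])] :=
    hrange.flatMap (((const true).pair hvar.singleton).cons hvar.var_poly)
  have hquadratic : PolyTime fun a => (List.range (F a).length).flatMap fun i =>
      (List.range (F a).length).map fun j => (false, [n a + i, n a + j]) :=
    hrange.flatMap ((hrange.comp fst).map ((const false).pair
      ((hvar.comp fst).cons ((hn.comp (fst.comp fst)).add snd).singleton)))
  exact hchosen.append (hlinear.append hquadratic)

protected theorem choiceLists (hn : PolyTime n) (hF : PolyTime F) (D : ℕ) :
    PolyTime fun a => choiceLists (n a) D (F a) :=
  (hn.add hF.length).range.positivize (hn.choicePoly hF) (D + 1)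

protected theorem choiceBound (hn : PolyTime n) (hk : PolyTime k) (hF : PolyTime F) (D : ℕ) :
    PolyTime fun a => choiceBound (n a) D (k a) (F a) :=
  (const 1).add (((hn.choicePoly hF).negCount.add (const 1)).mul
    ((hk.add (const 1)).tupleCount (D + 1)))

protected theorem cliqueEdges {c : α → ℕ} {H : α → List (List ℕ)} (hc : PolyTime c)
    (hH : PolyTime H) : PolyTime fun a => cliqueEdges (c a) (H a) :=
  (hc.range.flatMap (((hc.comp fst).range.filter ((snd.comp fst).decide_eq snd).not).map
    ((snd.comp fst).pair snd))).append
    (hH.length.range.flatMap (((hH.comp fst).getD snd []).map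
      (snd.pair ((hc.comp (fst.comp fst)).add (snd.comp fst)))))

protected theorem cutInstance (hn : PolyTime n) (hk : PolyTime k) (hF : PolyTime F) (D : ℕ) :
    PolyTime fun a => cutInstance (n a) D (k a) (F a) := by
  have hH := hn.choiceLists hF D
  have hc := (hn.add hF.length).add (hk.add (const 3))
  have hN := (hc.add hH.length).sub ((hk.add (const 1)).add (hn.choiceBound hk hF D))
  exact (enc_iff.mpr ((hc.add hH.length).pair ((hc.cliqueEdges hH).pair
    (hN.mul (hN.sub (const 1)))))).pair (hk.add (const 1))

protected theorem cutReduction (h : ℕ) : PolyTime (cutReduction h) := by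
  have hC : PolyTime fun a : SExp × ℕ => Circuit.decode a.1 := circuit_decode.comp fst
  have hvalid := ((enc_iff.mpr hC).decide_eq fst).and (hC.isAdmissible h)
  exact hvalid.ite (hC.inputs.cutInstance snd (hC.outputGuesses h) (2 ^ h)) (const (SExp.nil, 0))

end Reduction

end PolyTime

end ParamComplexity

/-- Critical Node Cut is `W[1]`-hard with respect to the cut size `k`. -/
theorem mainTheorem2 : ParamComplexity.W1Hard ParamComplexity.criticalNodeCut := by
  rintro A ⟨h, hA⟩
  exact hA.trans_polyTime (ParamComplexity.PolyTime.cutReduction h) Primrec.succ.to_comp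
    (ParamComplexity.cutReduction_snd_le h) (fun _ _ => Nat.succ_le_succ)
    (ParamComplexity.mem_weightedCircuitSat_iff_cutReduction_mem h)
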